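/- **Corollary (Error of CCD).** *Setting.* Let $\mathbb L\subset\mathbb R^3$ be a Bravais lattice with unit cell $\Omega$, and $\mathbb L^*$ its reciprocal lattice with Brillouin zone (unit cell) $\Omega^*$. Let $\psi_{n\mathbf k}(\mathbf r)=e^{\mathrm i\mathbf k\cdot\mathbf r}u_{n\mathbf k}(\mathbf r)$ be Bloch orbitals with finitely many occupied bands ($i,j,k,l$) and virtual bands ($a,b,c,d$), with $u_{n\mathbf k}$ continuous and $\mathbb L$-periodic, $\int_\Omega\overline{u_{n\mathbf k}}u_{m\mathbf k}=\delta_{nm}$, and let $\varepsilon_{n\mathbf k}\in\mathbb R$ be orbital energies. Assume that $\psi_{n\mathbf k}$ and $\varepsilon_{n\mathbf k}$ are $\mathbb L^*$-periodic in $\mathbf k$, that $\mathbf k\mapsto u_{n\mathbf k}$ (in the uniform norm) and $\mathbf k\mapsto\varepsilon_{n\mathbf k}$ are $C^\infty$, that there is a direct gap, $\varepsilon_{i\mathbf k}<\varepsilon_{a\mathbf k}$, and that $\varepsilon_{IJ}^{AB}:=\varepsilon_I+\varepsilon_J-\varepsilon_A-\varepsilon_B$ never vanishes when $\mathbf k_i+\mathbf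 k_j-\mathbf k_a-\mathbf k_b\in\mathbb L^*$. Here $P=(p,\mathbf k_p)$ denotes an orbital. With $\mathbf q=\mathbf k_3-\mathbf k_1$, $\mathbf k_4=\mathbf k_1+\mathbf k_2-\mathbf k_3$ and $\hat\varrho_{n'\mathbf k',n\mathbf k}(\mathbf G)=\int_\Omega\overline{u_{n'\mathbf k'}}\,e^{-\mathrm i\mathbf G\cdot\mathbf r}u_{n\mathbf k}\,d\mathbf r$ put $$\langle n_1\mathbf k_1,n_2\mathbf k_2|n_3\mathbf k_3,n_4\mathbf k_4\rangle=\frac{4\pi}{|\Omega|}\sum_{\mathbf G\in\mathbb L^*,\ \mathbf q+\mathbf G\ne 0}\frac{\hat\varrho_{n_1\mathbf k_1,n_3\mathbf k_3}(\mathbf G)\,\hat\varrho_{n_2\mathbf k_2,n_4\mathbf k_4}(-\mathbf G)}{|\mathbf q+\mathbf G|^2},\qquad W_{ijab}=2\langle IJ|AB\rangle-\langle IJ|BA\rangle .$$ For each $m\ge1$ let $\mathcal K$ be a uniform $m\times m\times m$ mesh of $\Omega^*$ (with any offset), with $N_{\mathbf k}=m^3$ points. Amplitudes are arrays $T_{ijab}(\mathbf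 k_i,\mathbf k_j,\mathbf k_a)$, written $t_{IJ}^{AB}$ with $\mathbf k_b=\mathbf k_i+\mathbf k_j-\mathbf k_a$ modulo $\mathbb L^*$; momenta range over $\mathcal K$ (tensors) or over $\mathbb R^3$, periodically (thermodynamic limit, TDL). The finite CCD map is $$\mathcal F_{N_{\mathbf k}}(t)_{IJ}^{AB}=\frac1{\varepsilon_{IJ}^{AB}}\Big[\langle AB|IJ\rangle+\mathcal P\Big(\sum_C\kappa_C^At_{IJ}^{CB}-\sum_K\kappa_I^Kt_{KJ}^{AB}\Big)+\frac1{N_{\mathbf k}}\sum_{KL}\chi_{IJ}^{KL}t_{KL}^{AB}+\frac1{N_{\mathbf k}}\sum_{CD}\langle AB|CD\rangle t_{IJ}^{CD}+\mathcal P\Big(\frac1{N_{\mathbf k}}\sum_{KC}\big\{(2\chi_{IC}^{AK}-\chi_{CI}^{AK})t_{KJ}^{CB}-\chi_{IC}^{AK}t_{KJ}^{BC}-\chi_{CJ}^{AK}t_{KI}^{BC}\big\}\Big)\Big],$$ where $\mathcal P(f)_{IJ}^{AB}=f_{IJ}^{AB}+f_{JI}^{BA}$, all sums run over bands and over mesh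 momenta subject to crystal momentum conservation (in particular $\mathbf k_c=\mathbf k_a$ in $\kappa_C^A$ and $\mathbf k_k=\mathbf k_i$ in $\kappa_I^K$), and $$\kappa_C^A=-\tfrac1{N_{\mathbf k}^2}\sum_{KLD}(2\langle KL|CD\rangle-\langle KL|DC\rangle)t_{KL}^{AD},\qquad \kappa_I^K=\tfrac1{N_{\mathbf k}^2}\sum_{LCD}(2\langle KL|CD\rangle-\langle KL|DC\rangle)t_{IL}^{CD},$$ $$\chi_{IJ}^{KL}=\langle KL|IJ\rangle+\tfrac1{N_{\mathbf k}}\sum_{CD}\langle KL|CD\rangle t_{IJ}^{CD},\qquad \chi_{CI}^{AK}=\langle AK|CI\rangle-\tfrac1{2N_{\mathbf k}}\sum_{LD}\langle LK|CD\rangle t_{IL}^{DA},$$ $$\chi_{IC}^{AK}=\langle AK|IC\rangle+\tfrac1{2N_{\mathbf k}}\sum_{LD}\big\{(2\langle LK|DC\rangle-\langle LK|CD\rangle)t_{IL}^{AD}-\langle LK|DC\rangle t_{IL}^{DA}\big\}.$$ The TDL map $\mathcal F_{\rm TDL}$ is given by the same formulas with every average $N_{\mathbf k}^{-1}\sum_{\mathbf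 k\in\mathcal K}$ replaced by $|\Omega^*|^{-1}\int_{\Omega^*}d\mathbf k$. The energies of amplitudes are $$\mathcal G_{N_{\mathbf k}}(T)=\frac1{N_{\mathbf k}^3}\sum_{\mathbf k_i,\mathbf k_j,\mathbf k_a\in\mathcal K}\sum_{ijab}W_{ijab}T_{ijab},\qquad \mathcal G_{\rm TDL}(t)=\frac1{|\Omega^*|^3}\int_{(\Omega^*)^3}\sum_{ijab}W_{ijab}t_{ijab}\,d\mathbf k_i\,d\mathbf k_j\,d\mathbf k_a .$$ Let $\mathbb T(\Omega^*)$ be the space of functions $f(\mathbf k_i,\mathbf k_j,\mathbf k_a)$ that are $\mathbb L^*$-periodic in each variable, $C^\infty$ where $\mathbf k_a-\mathbf k_i\notin\mathbb L^*$, $C^\infty$ in $(\mathbf k_i,\mathbf k_j)$ on $\mathbf k_a=\mathbf k_i$, and have algebraic singularity of order $0$ there: $g(\mathbf q;\mathbf k_i,\mathbf k_j)=f(\mathbf k_i,\mathbf k_j,\mathbf k_i+\mathbf q)$ is $C^\infty$ in $(\mathbf k_i,\mathbf k_j)$ for each fixed $\mathbf q$, and there is $\delta>0$ such that for all multi-indices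 $|\partial_{\mathbf q}^{\alpha}\partial_{(\mathbf k_i,\mathbf k_j)}^{\beta}g|\le C_{\alpha,\beta}|\mathbf q|^{-|\alpha|}$ for $0<|\mathbf q|<\delta$, uniformly in $\mathbf k_i,\mathbf k_j$. Let $\mathcal M_{\mathcal K}$ be the map that evaluates a TDL amplitude on $\mathcal K^3$, and let $\|\cdot\|_\infty$ be the maximum over bands of the supremum over momenta of the absolute value. *Assumptions.* Let $0\le L<1$ be independent of $N_{\mathbf k}$. 1. $\mathbb B_{\rm TDL}$ is a set of TDL amplitudes with all entries in $\mathbb T(\Omega^*)$; it contains $0$ and a fixed point $t_*=\mathcal F_{\rm TDL}(t_*)$; $\mathcal F_{\rm TDL}(\mathbb B_{\rm TDL})\subset\mathbb B_{\rm TDL}$, and $\|\mathcal F_{\rm TDL}(t)-\mathcal F_{\rm TDL}(s)\|_\infty\le L\|t-s\|_\infty$ for $t,s\in\mathbb B_{\rm TDL}$. 2. For all sufficiently large $N_{\mathbf k}$, $\mathbb B_{N_{\mathbf k}}$ is a set of amplitude tensors containing $0$ and a fixed point $T_*^{N_{\mathbf k}}=\mathcal F_{N_{\mathbf k}}(T_*^{N_{\mathbf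 k}})$; $\mathcal F_{N_{\mathbf k}}(\mathbb B_{N_{\mathbf k}})\subset\mathbb B_{N_{\mathbf k}}$, and $\|\mathcal F_{N_{\mathbf k}}(T)-\mathcal F_{N_{\mathbf k}}(S)\|_\infty\le L\|T-S\|_\infty$ for $T,S\in\mathbb B_{N_{\mathbf k}}$. 3. For all sufficiently large $N_{\mathbf k}$, $\mathcal M_{\mathcal K}\mathbb B_{\rm TDL}\subset\mathbb B_{N_{\mathbf k}}$. 4. For the iterates $t_0=0$, $t_n=\mathcal F_{\rm TDL}(t_{n-1})$ there is a constant $C$, independent of $n$ and $N_{\mathbf k}$, such that for all sufficiently large $N_{\mathbf k}$ and all $n>0$: $\|\mathcal M_{\mathcal K}\mathcal F_{\rm TDL}(t_n)-\mathcal F_{N_{\mathbf k}}(\mathcal M_{\mathcal K}t_n)\|_\infty\le CN_{\mathbf k}^{-1/3}$. *Conclusion.* The finite-size error of the converged CCD energy satisfies $$\big|E^{\rm TDL}_{\rm CCD}-E^{N_{\mathbf k}}_{\rm CCD}\big|=\big|\mathcal G_{\rm TDL}(t_*)-\mathcal G_{N_{\mathbf k}}(T_*^{N_{\mathbf k}})\big|=\mathcal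 O\big(N_{\mathbf k}^{-1/3}\big)\qquad(N_{\mathbf k}=m^3\to\infty).$$ -/

import Mathlib

open scoped NNReal ENNReal ContDiff BoundedContinuousFunction
open MeasureTheory Filter Asymptotics

noncomputable section

namespace PeriodicCCD

/-- Physical space, which is also momentum space. -/
abbrev E : Type := EuclideanSpace ℝ (Fin 3)

/-- Band indices: `Sum.inl` for the occupied bands, `Sum.inr` for the virtual bands. -/
abbrev Band (nocc nvir : ℕ) : Type := Fin nocc ⊕ Fin nvir

/-! ### Lattices -/

theorem inner_nondegenerate : (innerₗ E : LinearMap.BilinForm ℝ E).Nondegenerate := by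
  constructor
  · intro x hx
    exact inner_self_eq_zero.mp (hx x)
  · intro x hx
    exact inner_self_eq_zero.mp (hx x)

/-- The reciprocal basis `b₀, b₁, b₂` of primitive vectors `a₀, a₁, a₂`,
determined by `⟪bᵢ, aⱼ⟫ = 2π δᵢⱼ`. -/
def recipBasis (a : Module.Basis (Fin 3) ℝ E) : Module.Basis (Fin 3) ℝ E :=
  (LinearMap.BilinForm.dualBasis (innerₗ E) inner_nondegenerate a).isUnitSMul
    (w := fun _ => 2 * Real.pi) (fun _ => (mul_pos two_pos Real.pi_pos).ne'.isUnit)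

theorem inner_recipBasis (a : Module.Basis (Fin 3) ℝ E) (i j : Fin 3) :
    inner ℝ (recipBasis a i) (a j) = if j = i then 2 * Real.pi else 0 := by
  have h := LinearMap.BilinForm.apply_dualBasis_left (B := innerₗ E) inner_nondegenerate a i j
  rw [innerₗ_apply_apply] at h
  rw [recipBasis, Module.Basis.isUnitSMul_apply, inner_smul_left, h]
  simp

/-- The lattice generated by a basis. -/
abbrev lattice (b : Module.Basis (Fin 3) ℝ E) : Submodule ℤ E :=
  Submodule.span ℤ (Set.range b)

/-! ### Periodic systems -/

/-- A gapped periodic system with `nocc` occupied and `nvir` virtual bands. The (normalized) Bloch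
orbitals are `ψ_{nk}(r) = exp(i k·r) u_{nk}(r)`. -/
structure PeriodicSystem (nocc nvir : ℕ) where
  /-- Primitive vectors of the Bravais lattice. -/
  prim : Module.Basis (Fin 3) ℝ E
  /-- `u n k r` is the cell-periodic part `u_{nk}(r)` of the orbital `ψ_{nk}`. -/
  u : Band nocc nvir → E → (E →ᵇ ℂ)
  /-- The orbital energies `ε_{nk}`. -/
  energy : Band nocc nvir → E → ℝ
  /-- `u_{nk}` is periodic with respect to the Bravais lattice. -/
  u_periodic : ∀ n k, ∀ R ∈ lattice prim, ∀ r, u n k (r + R) = u n k r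
  /-- `∫_Ω conj(u_{nk}) u_{mk} = δ_{nm}`. -/
  orthonormal : ∀ n m k,
    ∫ r in ZSpan.fundamentalDomain prim, (starRingEnd ℂ) (u n k r) * u m k r
      = if n = m then 1 else 0
  /-- The orbitals depend smoothly on `k`. -/
  u_smooth : ∀ n, ContDiff ℝ ∞ (u n)
  /-- Periodic gauge: `ψ_{n,k+G} = ψ_{nk}` for reciprocal lattice vectors `G`. -/
  gauge : ∀ n k, ∀ G ∈ lattice (recipBasis prim), ∀ r,
    u n (k + G) r = Complex.exp (-(Complex.I * (inner ℝ G r : ℝ))) * u n k r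
  /-- The orbital energies depend smoothly on `k`. -/
  energy_smooth : ∀ n, ContDiff ℝ ∞ (energy n)
  /-- The orbital energies are periodic in `k`. -/
  energy_periodic : ∀ n k, ∀ G ∈ lattice (recipBasis prim), energy n (k + G) = energy n k
  /-- Direct gap between occupied and virtual bands. -/
  gap : ∀ (i : Fin nocc) (a : Fin nvir) k, energy (Sum.inl i) k < energy (Sum.inr a) k
  /-- The energy denominators `ε_I + ε_J - ε_A - ε_B` of the amplitude equation do not vanish. -/
  denom_ne_zero : ∀ (i j : Fin nocc) (a b : Fin nvir) (ki kj ka : E),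
    energy (Sum.inl i) ki + energy (Sum.inl j) kj
      - energy (Sum.inr a) ka - energy (Sum.inr b) (ki + kj - ka) ≠ 0

/-- Amplitudes `T_{ijab}(k_i, k_j, k_a)` with momenta in `K`: tensors if `K` is a finite mesh,
families of functions if `K` is momentum space. -/
abbrev Amp (nocc nvir : ℕ) (K : Type) : Type :=
  Fin nocc → Fin nocc → Fin nvir → Fin nvir → K → K → K → ℂ

/-- The data that distinguish the amplitude equation on a mesh from that in the thermodynamic
limit: which momentum an index stands for, and how one averages over one or two momenta. -/
structure MomentumRule (K : Type) where
  point : K → E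
  avg : (K → ℂ) → ℂ
  avg₂ : (K → K → ℂ) → ℂ

/-- The index group of an `m × m × m` Monkhorst-Pack mesh. -/
abbrev MeshIndex (m : ℕ+) : Type := Fin 3 → ZMod (m : ℕ)

/-- The number `N_k = m³` of mesh points. -/
def Nk (m : ℕ+) : ℕ := (m : ℕ) ^ 3

namespace PeriodicSystem

variable {nocc nvir : ℕ} (S : PeriodicSystem nocc nvir)

/-- The unit cell `Ω`. -/
def cell : Set E := ZSpan.fundamentalDomain S.prim

/-- The reciprocal lattice `𝕃*`. -/
abbrev recipLattice : Submodule ℤ E := lattice (recipBasis S.prim)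

/-- The Brillouin zone `Ω*`: a unit cell of the reciprocal lattice. -/
def brillouinZone : Set E := ZSpan.fundamentalDomain (recipBasis S.prim)

/-- The pair product `ϱ̂_{n'k',nk}(G) = ⟨ψ_{n'k'} | exp(i(k' - k - G)·r) | ψ_{nk}⟩`
`= ∫_Ω conj(u_{n'k'}(r)) exp(-i G·r) u_{nk}(r) dr`. -/
def pairProduct (n' : Band nocc nvir) (k' : E) (n : Band nocc nvir) (k G : E) : ℂ :=
  ∫ r in S.cell, (starRingEnd ℂ) (S.u n' k' r)
    * Complex.exp (-(Complex.I * (inner ℝ G r : ℝ))) * S.u n k r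

/-- The normalized electron repulsion integral `⟨n₁k₁, n₂k₂ | n₃k₃, n₄k₄⟩` with
`k₄ = k₁ + k₂ - k₃` and momentum transfer `q = k₃ - k₁`. The singular term `q + G = 0`, which
occurs only if `q` is a reciprocal lattice vector, is omitted. -/
def eri (n₁ n₂ n₃ n₄ : Band nocc nvir) (k₁ k₂ k₃ : E) : ℂ :=
  open Classical in
  ((4 * Real.pi / (volume S.cell).toReal : ℝ) : ℂ) *
    ∑' G : S.recipLattice,
      if k₃ - k₁ + (G : E) = 0 then 0
      else ((1 / ‖k₃ - k₁ + (G : E)‖ ^ 2 : ℝ) : ℂ)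
        * S.pairProduct n₁ k₁ n₃ k₃ (G : E)
        * S.pairProduct n₂ k₂ n₄ (k₁ + k₂ - k₃) (-(G : E))

/-- `W_{ijab}(k_i, k_j, k_a) = 2⟨IJ|AB⟩ - ⟨IJ|BA⟩`. -/
def antisymERI (i j : Fin nocc) (a b : Fin nvir) (ki kj ka : E) : ℂ :=
  2 * S.eri (.inl i) (.inl j) (.inr a) (.inr b) ki kj ka
    - S.eri (.inl i) (.inl j) (.inr b) (.inr a) ki kj (ki + kj - ka)

/-! ### The mesh and the thermodynamic limit -/

/-- The points `k₀ + ∑ₛ (xₛ/m) bₛ`, `0 ≤ xₛ < m`, of the uniform mesh with offset `k₀`. Modulo the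
reciprocal lattice, `k_i + k_j - k_a` corresponds to `x_i + x_j - x_a`. -/
def meshPoint (k₀ : E) (m : ℕ+) (x : MeshIndex m) : E :=
  k₀ + ∑ s, (((x s).val : ℝ) / (m : ℝ)) • recipBasis S.prim s

/-- Averages over the mesh. -/
def meshRule (k₀ : E) (m : ℕ+) : MomentumRule (MeshIndex m) where
  point := S.meshPoint k₀ m
  avg f := (1 / (Nk m : ℂ)) * ∑ x, f x
  avg₂ f := (1 / (Nk m : ℂ) ^ 2) * ∑ x, ∑ y, f x y

/-- Averages `|Ω*|⁻¹ ∫_{Ω*}` and `|Ω*|⁻² ∫_{Ω* × Ω*}` over the Brillouin zone. -/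
def tdlRule : MomentumRule E where
  point := id
  avg f := ⨍ k in S.brillouinZone, f k
  avg₂ f := ⨍ p in S.brillouinZone ×ˢ S.brillouinZone, f p.1 p.2

/-! ### The amplitude equation

In the definitions below `ki, kj, ka, …` are the momenta of the orbitals `I, J, A, …`, and the
remaining momenta are given by crystal momentum conservation. -/

section AmplitudeMap

variable {K : Type} [AddCommGroup K] (P : MomentumRule K) (t : Amp nocc nvir K)

/-- The electron repulsion integral at momenta indexed by `K`. -/
def eriAt (n₁ n₂ n₃ n₄ : Band nocc nvir) (k₁ k₂ k₃ : K) : ℂ :=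
  S.eri n₁ n₂ n₃ n₄ (P.point k₁) (P.point k₂) (P.point k₃)

/-- `ε_{IJ}^{AB} = ε_I + ε_J - ε_A - ε_B`. -/
def denom (i j : Fin nocc) (a b : Fin nvir) (ki kj ka : K) : ℝ :=
  S.energy (.inl i) (P.point ki) + S.energy (.inl j) (P.point kj)
    - S.energy (.inr a) (P.point ka) - S.energy (.inr b) (P.point (ki + kj - ka))

/-- `κ_C^A`, where `k_c = k_a`. -/
def kappaVir (c a : Fin nvir) (ka : K) : ℂ :=
  -P.avg₂ fun kk kl => ∑ k : Fin nocc, ∑ l : Fin nocc, ∑ d : Fin nvir,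
    (2 * S.eriAt P (.inl k) (.inl l) (.inr c) (.inr d) kk kl ka
      - S.eriAt P (.inl k) (.inl l) (.inr d) (.inr c) kk kl (kk + kl - ka))
      * t k l a d kk kl ka

/-- `κ_I^K`, where `k_k = k_i`. -/
def kappaOcc (i k : Fin nocc) (ki : K) : ℂ :=
  P.avg₂ fun kc kd => ∑ l : Fin nocc, ∑ c : Fin nvir, ∑ d : Fin nvir,
    (2 * S.eriAt P (.inl k) (.inl l) (.inr c) (.inr d) ki (kc + kd - ki) kc
      - S.eriAt P (.inl k) (.inl l) (.inr d) (.inr c) ki (kc + kd - ki) kd)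
      * t i l c d ki (kc + kd - ki) kc

/-- `χ_{IJ}^{KL}`, where `k_l = k_i + k_j - k_k`. -/
def chiIJ (i j k l : Fin nocc) (ki kj kk : K) : ℂ :=
  S.eriAt P (.inl k) (.inl l) (.inl i) (.inl j) kk (ki + kj - kk) ki
    + P.avg fun kc => ∑ c : Fin nvir, ∑ d : Fin nvir,
        S.eriAt P (.inl k) (.inl l) (.inr c) (.inr d) kk (ki + kj - kk) kc
          * t i j c d ki kj kc

/-- `χ_{IC}^{AK}`, where `k_c = k_a + k_k - k_i` (and `k_d = k_i + k_l - k_a` in the sum). -/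
def chiIC (i : Fin nocc) (c a : Fin nvir) (k : Fin nocc) (ki ka kk : K) : ℂ :=
  S.eriAt P (.inr a) (.inl k) (.inl i) (.inr c) ka kk ki
    + 1 / 2 * P.avg fun kl => ∑ l : Fin nocc, ∑ d : Fin nvir,
        ((2 * S.eriAt P (.inl l) (.inl k) (.inr d) (.inr c) kl kk (ki + kl - ka)
            - S.eriAt P (.inl l) (.inl k) (.inr c) (.inr d) kl kk (ka + kk - ki))
            * t i l a d ki kl ka
          - S.eriAt P (.inl l) (.inl k) (.inr d) (.inr c) kl kk (ki + kl - ka)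
            * t i l d a ki kl (ki + kl - ka))

/-- `χ_{CI}^{AK}`, where `k_c = k_a + k_k - k_i` (and `k_d = k_i + k_l - k_a` in the sum). -/
def chiCI (c : Fin nvir) (i : Fin nocc) (a : Fin nvir) (k : Fin nocc) (ki ka kk : K) : ℂ :=
  S.eriAt P (.inr a) (.inl k) (.inr c) (.inl i) ka kk (ka + kk - ki)
    - 1 / 2 * P.avg fun kl => ∑ l : Fin nocc, ∑ d : Fin nvir,
        S.eriAt P (.inl l) (.inl k) (.inr c) (.inr d) kl kk (ka + kk - ki)
          * t i l d a ki kl (ki + kl - ka)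

/-- `∑_C κ_C^A t_{IJ}^{CB} - ∑_K κ_I^K t_{KJ}^{AB}`. -/
def kappaTerm (i j : Fin nocc) (a b : Fin nvir) (ki kj ka : K) : ℂ :=
  ∑ c : Fin nvir, S.kappaVir P t c a ka * t i j c b ki kj ka
    - ∑ k : Fin nocc, S.kappaOcc P t i k ki * t k j a b ki kj ka

/-- The average over `K, C` of
`(2χ_{IC}^{AK} - χ_{CI}^{AK}) t_{KJ}^{CB} - χ_{IC}^{AK} t_{KJ}^{BC} - χ_{CJ}^{AK} t_{KI}^{BC}`,
where `k_c = k_a + k_k - k_i` in the first two products and `k_c = k_a + k_k - k_j` in the last. -/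
def ringTerm (i j : Fin nocc) (a b : Fin nvir) (ki kj ka : K) : ℂ :=
  P.avg fun kk => ∑ k : Fin nocc, ∑ c : Fin nvir,
    ((2 * S.chiIC P t i c a k ki ka kk - S.chiCI P t c i a k ki ka kk)
        * t k j c b kk kj (ka + kk - ki)
      - S.chiIC P t i c a k ki ka kk * t k j b c kk kj (ki + kj - ka)
      - S.chiCI P t c j a k kj ka kk * t k i b c kk ki (ki + kj - ka))

/-- The average over `K, L` of `χ_{IJ}^{KL} t_{KL}^{AB}`. -/
def holeLadderTerm (i j : Fin nocc) (a b : Fin nvir) (ki kj ka : K) : ℂ :=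
  P.avg fun kk => ∑ k : Fin nocc, ∑ l : Fin nocc,
    S.chiIJ P t i j k l ki kj kk * t k l a b kk (ki + kj - kk) ka

/-- The average over `C, D` of `χ_{CD}^{AB} t_{IJ}^{CD}`, where `χ_{CD}^{AB} = ⟨AB|CD⟩`. -/
def particleLadderTerm (i j : Fin nocc) (a b : Fin nvir) (ki kj ka : K) : ℂ :=
  P.avg fun kc => ∑ c : Fin nvir, ∑ d : Fin nvir,
    S.eriAt P (.inr a) (.inr b) (.inr c) (.inr d) ka (ki + kj - ka) kc * t i j c d ki kj kc

/-- The permutation operator `𝒫(⋯)_{IJ}^{AB} = (⋯)_{IJ}^{AB} + (⋯)_{JI}^{BA}`. -/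
def permute (f : Amp nocc nvir K) : Amp nocc nvir K := fun i j a b ki kj ka =>
  f i j a b ki kj ka + f j i b a kj ki (ki + kj - ka)

/-- The right hand side of the CCD amplitude equation, as a map of the amplitude. -/
def amplitudeMap : Amp nocc nvir K := fun i j a b ki kj ka =>
  (1 / (S.denom P i j a b ki kj ka : ℂ)) *
    (S.eriAt P (.inr a) (.inr b) (.inl i) (.inl j) ka (ki + kj - ka) ki
      + permute (S.kappaTerm P t) i j a b ki kj ka
      + S.holeLadderTerm P t i j a b ki kj ka
      + S.particleLadderTerm P t i j a b ki kj ka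
      + permute (S.ringTerm P t) i j a b ki kj ka)

end AmplitudeMap

/-- The amplitude map `ℱ_{N_k}` on the mesh. -/
def mapFin (k₀ : E) (m : ℕ+) (T : Amp nocc nvir (MeshIndex m)) : Amp nocc nvir (MeshIndex m) :=
  S.amplitudeMap (S.meshRule k₀ m) T

/-- The amplitude map `ℱ_TDL` in the thermodynamic limit. -/
def mapTDL (t : Amp nocc nvir E) : Amp nocc nvir E :=
  S.amplitudeMap S.tdlRule t

/-- The sampling map `ℳ_𝒦`. -/
def sample (k₀ : E) (m : ℕ+) (t : Amp nocc nvir E) : Amp nocc nvir (MeshIndex m) :=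
  fun i j a b x y z =>
    t i j a b (S.meshPoint k₀ m x) (S.meshPoint k₀ m y) (S.meshPoint k₀ m z)

/-- The correlation energy `𝒢_{N_k}(T)` of an amplitude on the mesh. -/
def energyFin (k₀ : E) (m : ℕ+) (T : Amp nocc nvir (MeshIndex m)) : ℂ :=
  (1 / (Nk m : ℂ) ^ 3) * ∑ x, ∑ y, ∑ z, ∑ i, ∑ j, ∑ a, ∑ b,
    S.antisymERI i j a b (S.meshPoint k₀ m x) (S.meshPoint k₀ m y) (S.meshPoint k₀ m z)
      * T i j a b x y z

/-- The correlation energy `𝒢_TDL(t)` of an amplitude in the thermodynamic limit. -/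
def energyTDL (t : Amp nocc nvir E) : ℂ :=
  ⨍ p in S.brillouinZone ×ˢ S.brillouinZone ×ˢ S.brillouinZone,
    ∑ i, ∑ j, ∑ a, ∑ b, S.antisymERI i j a b p.1 p.2.1 p.2.2 * t i j a b p.1 p.2.1 p.2.2

end PeriodicSystem

/-! ### The function space of exact amplitudes -/

/-- `f(x, y)` is smooth in `y` for every fixed `x`, and has algebraic singularity of order `γ` with
respect to `x` at `x₀`: near `x₀` the derivatives of order `p` in `x` and `q` in `y` are bounded by
a constant, which does not depend on `y`, times `|x - x₀| ^ (γ - p)`. -/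
def HasAlgebraicSingularity {X Y : Type*} [NormedAddCommGroup X] [NormedSpace ℝ X]
    [NormedAddCommGroup Y] [NormedSpace ℝ Y] (f : X → Y → ℂ) (x₀ : X) (γ : ℝ) : Prop :=
  (∀ x, ContDiff ℝ ∞ (f x)) ∧
  ∃ δ > 0, ∀ p q : ℕ, ∃ C : ℝ, ∀ x, 0 < ‖x - x₀‖ → ‖x - x₀‖ < δ → ∀ y,
    ‖iteratedFDeriv ℝ p (fun x' => iteratedFDeriv ℝ q (f x') y) x‖
      ≤ C * ‖x - x₀‖ ^ (γ - (p : ℝ))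

namespace PeriodicSystem

variable {nocc nvir : ℕ} (S : PeriodicSystem nocc nvir)

/-- The function space `𝕋(Ω*)`. -/
structure InT (f : E → E → E → ℂ) : Prop where
  /-- `f` is periodic in each variable. -/
  periodic : ∀ G ∈ S.recipLattice, ∀ ki kj ka,
    f (ki + G) kj ka = f ki kj ka ∧ f ki (kj + G) ka = f ki kj ka ∧ f ki kj (ka + G) = f ki kj ka
  /-- `f` is smooth except at `k_a = k_i` (and the periodic images). -/
  smooth : ContDiffOn ℝ ∞ (fun p : E × E × E => f p.1 p.2.1 p.2.2)
    {p | p.2.2 - p.1 ∉ S.recipLattice}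
  /-- As a function of `q = k_a - k_i` and `(k_i, k_j)`, `f` has algebraic singularity of order `0`
  at `q = 0`. -/
  singularity : HasAlgebraicSingularity
    (fun (q : E) (y : E × E) => f y.1 y.2 (y.1 + q)) 0 0
  /-- `f` is smooth with respect to `k_i, k_j` at the nonsmooth point `k_a = k_i`. -/
  smooth_diag : ContDiff ℝ ∞ (fun y : E × E => f y.1 y.2 y.1)

/-- The amplitudes all of whose entries lie in `𝕋(Ω*)`. -/
def amplitudeSpace : Set (Amp nocc nvir E) :=
  {t | ∀ i j a b, S.InT (t i j a b)}

end PeriodicSystem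

/-- The norm `‖t‖_∞ = max_{ijab} sup |t_{ijab}|` of an amplitude: for tensors the entrywise max norm,
and in the thermodynamic limit the supremum over all momenta. -/
def supNorm {nocc nvir : ℕ} {K : Type} (t : Amp nocc nvir K) : ℝ≥0∞ :=
  ⨆ (i) (j) (a) (b) (ki) (kj) (ka), ‖t i j a b ki kj ka‖ₑ

end PeriodicCCD

end

open PeriodicCCD

/-!
The error splits into the error of the amplitudes on the mesh and a quadrature error of the energy.

*Amplitudes.* Let `e_n` be the distance of the sampled iterate `t_n` from the fixed point on the mesh.
The one-step error estimate and the contraction property of the map on the mesh give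
`e_{n+1} ≤ ε + L e_n`. Since `t_n → t` in the sup norm, `t` being bounded, letting `n → ∞` shows that
sampling `t` gives the fixed point on the mesh up to `ε / (1 - L)` (`supNorm_sample_sub_le`). The
energy on the mesh is Lipschitz continuous in the amplitude, uniformly in the mesh, because
`W_{ijab}` is bounded.

*Quadrature.* The integrand `∑ W_{ijab} t_{ijab}` is `IsMildlySingular`: it is periodic and bounded,
and its difference quotients are at most of the order of the inverse distance to the set where one of
the momentum transfers `k_a - k_i` and `k_j - k_a` is a reciprocal lattice vector. In three dimensions
this inverse distance is integrable over the Brillouin zone (`lintegral_inv_latticeDist_lt_top`).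
The average of a periodic function is the average over `s` of its averages over the mesh translated
by `s`, and the translated mesh agrees, modulo the lattice and up to relabelling, with the mesh
translated by a vector of length `O(1/m)`. So the quadrature error is at most `O(1/m)` times the
average of the inverse distance (`norm_average_sub_mesh_average_le`).

*Mild singularity of the integrand.* For `t_{ijab}` this follows from the bounds on first derivatives
contained in an algebraic singularity of order `0`, by the mean value inequality. For `W_{ijab}` the
Coulomb sum is the `ℓ²` pairing of two families of the form `coupling`, that is, pair products
divided by `|q + G|`. Each pair product involves an occupied and a virtual band, so by orthonormality
it is `O(|q + G|)`, which takes care of the finitely many `G` with `|q + G| ≤ 1`; for the remaining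
`G`, Bessel's inequality on the unit cell bounds the `ℓ²` norm
(`exists_hasL2Bound_coupling`). Away from the lattice, Bessel's inequality for the difference of the
pair products and the variation of `1 / |q + G|` give the Lipschitz estimate
(`exists_hasL2Bound_coupling_sub`).
-/

noncomputable section

namespace PeriodicCCD

/-! ### Integrals of periodic functions over a unit cell -/

section PeriodicIntegral

variable {V ι : Type*} [NormedAddCommGroup V] [NormedSpace ℝ V] [Finite ι]
  [MeasurableSpace V] [BorelSpace V] (b : Module.Basis ι ℝ V) (μ : Measure V)
  [μ.IsAddHaarMeasure]

theorem isAddFundamentalDomain_preimage_add_right (v : V) :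
    IsAddFundamentalDomain (Submodule.span ℤ (Set.range b)).toAddSubgroup
      ((· + v) ⁻¹' ZSpan.fundamentalDomain b) μ :=
  (ZSpan.isAddFundamentalDomain' b μ).preimage_of_equiv
    (measurePreserving_add_right μ v).quasiMeasurePreserving
    (Function.bijective_id (α := (Submodule.span ℤ (Set.range b)).toAddSubgroup))
    (fun g x => by simp [AddSubgroup.vadd_def, add_assoc])

variable [FiniteDimensional ℝ V]

theorem setLIntegral_fundamentalDomain_add_right {f : V → ℝ≥0∞}
    (hf : ∀ G ∈ Submodule.span ℤ (Set.range b), ∀ x, f (x + G) = f x) (v : V) :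
    ∫⁻ x in ZSpan.fundamentalDomain b, f (x + v) ∂μ = ∫⁻ x in ZSpan.fundamentalDomain b, f x ∂μ := by
  have : Countable (Submodule.span ℤ (Set.range b)).toAddSubgroup :=
    inferInstanceAs (Countable (Submodule.span ℤ (Set.range b)))
  have hinv : ∀ (g : (Submodule.span ℤ (Set.range b)).toAddSubgroup) (x : V), f (g +ᵥ x) = f x := fun g x => by
    rw [AddSubgroup.vadd_def, vadd_eq_add, add_comm]; exact hf g g.2 x
  rw [← (isAddFundamentalDomain_preimage_add_right b μ (-v)).setLIntegral_eq
    (ZSpan.isAddFundamentalDomain' b μ) f hinv]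
  have h := (measurePreserving_add_right μ v).setLIntegral_comp_preimage_emb
    (MeasurableEquiv.addRight v).measurableEmbedding f ((· + -v) ⁻¹' ZSpan.fundamentalDomain b)
  rw [← h]
  congr 2
  ext x; simp

theorem setIntegral_fundamentalDomain_add_right {f : V → ℂ}
    (hf : ∀ G ∈ Submodule.span ℤ (Set.range b), ∀ x, f (x + G) = f x) (v : V) :
    ∫ x in ZSpan.fundamentalDomain b, f (x + v) ∂μ = ∫ x in ZSpan.fundamentalDomain b, f x ∂μ := by
  have : Countable (Submodule.span ℤ (Set.range b)).toAddSubgroup :=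
    inferInstanceAs (Countable (Submodule.span ℤ (Set.range b)))
  have hinv : ∀ (g : (Submodule.span ℤ (Set.range b)).toAddSubgroup) (x : V), f (g +ᵥ x) = f x := fun g x => by
    rw [AddSubgroup.vadd_def, vadd_eq_add, add_comm]; exact hf g g.2 x
  rw [← (isAddFundamentalDomain_preimage_add_right b μ (-v)).setIntegral_eq
    (ZSpan.isAddFundamentalDomain' b μ) hinv]
  have h := (measurePreserving_add_right μ v).setIntegral_preimage_emb
    (MeasurableEquiv.addRight v).measurableEmbedding f ((· + -v) ⁻¹' ZSpan.fundamentalDomain b)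
  rw [← h]
  congr 2
  ext x; simp

end PeriodicIntegral

/-! ### The distance to a lattice -/

section LatticeDistance

variable (b : Module.Basis (Fin 3) ℝ E)

/-- The distance from `q` to the lattice generated by `b`. -/
def latticeDist (q : E) : ℝ := Metric.infDist q (lattice b : Set E)

theorem lattice_nonempty : (lattice b : Set E).Nonempty := ⟨0, (lattice b).zero_mem⟩

theorem isClosed_lattice : IsClosed (lattice b : Set E) := by
  rw [← Submodule.coe_toAddSubgroup]
  exact AddSubgroup.isClosed_of_discrete

theorem latticeDist_nonneg (q : E) : 0 ≤ latticeDist b q := Metric.infDist_nonneg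

theorem latticeDist_pos_iff {q : E} : 0 < latticeDist b q ↔ q ∉ lattice b :=
  ((isClosed_lattice b).notMem_iff_infDist_pos (lattice_nonempty b)).symm

theorem latticeDist_le_norm_add (q : E) {G : E} (hG : G ∈ lattice b) :
    latticeDist b q ≤ ‖q + G‖ := by
  have := Metric.infDist_le_dist_of_mem (x := q) (s := (lattice b : Set E)) (y := -G)
    ((lattice b).neg_mem hG)
  rwa [dist_eq_norm, sub_neg_eq_add] at this

theorem latticeDist_le_norm (q : E) : latticeDist b q ≤ ‖q‖ := by
  simpa using latticeDist_le_norm_add b q (lattice b).zero_mem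

theorem exists_norm_add_eq_latticeDist (q : E) :
    ∃ G ∈ lattice b, ‖q + G‖ = latticeDist b q := by
  obtain ⟨y, hy, h⟩ := (isClosed_lattice b).exists_infDist_eq_dist (lattice_nonempty b) q
  exact ⟨-y, (lattice b).neg_mem hy, by rw [latticeDist, h, dist_eq_norm, sub_eq_add_neg]⟩

theorem latticeDist_le_add_norm_sub (q q' : E) :
    latticeDist b q ≤ latticeDist b q' + ‖q - q'‖ := by
  rw [← dist_eq_norm]; exact Metric.infDist_le_infDist_add_dist

theorem continuous_latticeDist : Continuous (latticeDist b) := Metric.continuous_infDist_pt _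

theorem latticeDist_add {G : E} (hG : G ∈ lattice b) (q : E) :
    latticeDist b (q + G) = latticeDist b q := by
  have key : ∀ (q G : E), G ∈ lattice b → latticeDist b q ≤ latticeDist b (q + G) := by
    intro q G hG
    obtain ⟨H, hH, h⟩ := exists_norm_add_eq_latticeDist b (q + G)
    rw [← h, add_assoc]
    exact latticeDist_le_norm_add b q ((lattice b).add_mem hG hH)
  refine le_antisymm ?_ (key q G hG)
  simpa using key (q + G) (-G) ((lattice b).neg_mem hG)

theorem latticeDist_neg (q : E) : latticeDist b (-q) = latticeDist b q := by
  have key : ∀ q : E, latticeDist b (-q) ≤ latticeDist b q := by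
    intro q
    obtain ⟨H, hH, h⟩ := exists_norm_add_eq_latticeDist b q
    rw [← h, ← norm_neg, neg_add]
    exact latticeDist_le_norm_add b (-q) ((lattice b).neg_mem hH)
  refine le_antisymm (key q) ?_
  simpa using key (-q)

theorem exists_add_mem_fundamentalDomain (q : E) :
    ∃ G ∈ lattice b, q + G ∈ ZSpan.fundamentalDomain b :=
  ⟨-(ZSpan.floor b q : E), (lattice b).neg_mem (ZSpan.floor b q).2, by
    rw [← sub_eq_add_neg]; exact ZSpan.fract_mem_fundamentalDomain b q⟩

theorem exists_norm_le_of_mem_fundamentalDomain :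
    ∃ R : ℝ, 0 < R ∧ ∀ q ∈ ZSpan.fundamentalDomain b, ‖q‖ ≤ R := by
  obtain ⟨R, hR⟩ := (ZSpan.fundamentalDomain_isBounded b).exists_norm_le
  exact ⟨max R 1, by positivity, fun q hq => (hR q hq).trans (le_max_left _ _)⟩

theorem exists_latticeDist_le : ∃ R : ℝ, 0 < R ∧ ∀ q, latticeDist b q ≤ R := by
  obtain ⟨R, hR0, hR⟩ := exists_norm_le_of_mem_fundamentalDomain b
  refine ⟨R, hR0, fun q => ?_⟩
  obtain ⟨G, hG, h⟩ := exists_add_mem_fundamentalDomain b q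
  exact (latticeDist_le_norm_add b q hG).trans (hR _ h)

theorem finite_lattice_norm_le (R : ℝ) : {G : E | G ∈ lattice b ∧ ‖G‖ ≤ R}.Finite := by
  refine (ZSpan.setFinite_inter b (Metric.isBounded_closedBall (x := (0 : E)) (r := R))).subset ?_
  rintro G ⟨hG, hR⟩
  exact ⟨by simpa using hR, hG⟩

theorem volume_fundamentalDomain_lt_top : volume (ZSpan.fundamentalDomain b) < ⊤ :=
  (ZSpan.fundamentalDomain_isBounded b).measure_lt_top

theorem lintegral_ball_inv_norm_lt_top (R : ℝ) :
    ∫⁻ q in Metric.ball (0 : E) R, (ENNReal.ofReal ‖q‖)⁻¹ < ⊤ := by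
  have h : IntegrableOn (fun x : E => ‖x‖⁻¹) (Metric.ball 0 R) := by
    rw [integrableOn_fun_norm_addHaar volume (f := fun r : ℝ => r⁻¹)]
    have hc : IntegrableOn (fun y : ℝ => y) (Set.Ioo 0 R) :=
      (continuous_id.integrableOn_Icc (a := 0) (b := R)).mono_set Set.Ioo_subset_Icc_self
    refine hc.congr_fun (fun y hy => ?_) measurableSet_Ioo
    have : y ≠ 0 := hy.1.ne'
    simp only [finrank_euclideanSpace_fin, smul_eq_mul]
    field_simp
  refine lt_of_eq_of_lt (lintegral_congr_ae ?_) h.2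
  have h0 : ∀ᵐ x : E ∂(volume.restrict (Metric.ball 0 R)), x ≠ 0 :=
    ae_restrict_of_ae (Measure.ae_ne volume 0)
  filter_upwards [h0] with x hx
  rw [← ENNReal.ofReal_inv_of_pos (norm_pos_iff.mpr hx), Real.enorm_eq_ofReal (by positivity)]

/-- In three dimensions the reciprocal of the distance to a lattice is locally integrable. -/
theorem lintegral_inv_latticeDist_lt_top :
    ∫⁻ q in ZSpan.fundamentalDomain b, (ENNReal.ofReal (latticeDist b q))⁻¹ < ⊤ := by
  obtain ⟨R, hR0, hR⟩ := exists_norm_le_of_mem_fundamentalDomain b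
  set S := (finite_lattice_norm_le b (2 * R)).toFinset with hS
  -- The nearest lattice point to a point of the unit cell is among the finitely many points of `S`.
  have hle : ∀ q ∈ ZSpan.fundamentalDomain b,
      (ENNReal.ofReal (latticeDist b q))⁻¹ ≤ ∑ G ∈ S, (ENNReal.ofReal ‖q + G‖)⁻¹ := by
    intro q hq
    obtain ⟨G, hG, h⟩ := exists_norm_add_eq_latticeDist b q
    have hGS : G ∈ S := by
      rw [hS, Set.Finite.mem_toFinset]
      refine ⟨hG, ?_⟩
      have h1 : ‖G‖ ≤ ‖q + G‖ + ‖q‖ := by simpa using norm_sub_le (q + G) q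
      have h2 := latticeDist_le_norm b q
      linarith [hR q hq]
    rw [← h]
    exact Finset.single_le_sum (f := fun G => (ENNReal.ofReal ‖q + G‖)⁻¹)
      (fun _ _ => zero_le) hGS
  calc _ ≤ ∫⁻ q in ZSpan.fundamentalDomain b, ∑ G ∈ S, (ENNReal.ofReal ‖q + G‖)⁻¹ :=
        setLIntegral_mono' (ZSpan.fundamentalDomain_measurableSet b) hle
    _ = ∑ G ∈ S, ∫⁻ q in ZSpan.fundamentalDomain b, (ENNReal.ofReal ‖q + G‖)⁻¹ := by
        refine lintegral_finsetSum _ fun G _ => ?_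
        fun_prop
    _ < ⊤ := by
        refine ENNReal.sum_lt_top.mpr fun G hG => ?_
        refine lt_of_le_of_lt ?_ (lintegral_ball_inv_norm_lt_top (R + ‖G‖ + 1))
        have h := (measurePreserving_add_right (volume : Measure E) G).setLIntegral_comp_preimage_emb
          (MeasurableEquiv.addRight G).measurableEmbedding
          (fun q => (ENNReal.ofReal ‖q‖)⁻¹) (Metric.ball 0 (R + ‖G‖ + 1))
        rw [← h]
        refine lintegral_mono_set fun q hq => ?_
        have := norm_add_le q G
        have := hR q hq
        simp only [Set.mem_preimage, Metric.mem_ball, dist_zero_right]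
        linarith

end LatticeDistance

/-! ### Quadrature on uniform meshes -/

section Quadrature

/-- Quadrature error of a periodic function `F` on a uniform mesh. The mesh enters only through its
translations: up to lattice vectors, translating the mesh by any vector `s` is a relabelling of the
mesh points followed by a translation by a vector of length at most `ρ`. The function may be
singular where `D` vanishes, as long as `1 / D` is integrable. -/
theorem norm_average_sub_mesh_average_le {V ι A : Type*} [NormedAddCommGroup V] [NormedSpace ℝ V]
    [Finite ι] [MeasurableSpace V] [BorelSpace V] [FiniteDimensional ℝ V]
    (b : Module.Basis ι ℝ V) (μ : Measure V) [μ.IsAddHaarMeasure]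
    [AddCommGroup A] [Fintype A] (pt : A → V) {ρ : ℝ} (hρ : 0 < ρ)
    (hpt : ∀ s : V, ∃ (n : A) (r : V), ‖r‖ ≤ ρ ∧
      ∀ x, ∃ G ∈ Submodule.span ℤ (Set.range b), pt x + s = pt (x + n) + r + G)
    {F : V → ℂ} (hF : ∀ G ∈ Submodule.span ℤ (Set.range b), ∀ x, F (x + G) = F x)
    (hmeas : AEStronglyMeasurable F μ) {M : ℝ} (hM : ∀ x, ‖F x‖ ≤ M)
    {D : V → ℝ} (hD : ∀ G ∈ Submodule.span ℤ (Set.range b), ∀ x, D (x + G) = D x)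
    (hDmeas : Measurable D)
    {C : ℝ} (hC : 0 < C) (hlip : ∀ x y, D x * ‖F x - F y‖ ≤ C * ‖x - y‖)
    (hfin : ∫⁻ x in ZSpan.fundamentalDomain b, (ENNReal.ofReal (D x))⁻¹ ∂μ < ⊤) :
    ‖(⨍ x in ZSpan.fundamentalDomain b, F x ∂μ) - (1 / (Fintype.card A : ℂ)) * ∑ x, F (pt x)‖
      ≤ C * ρ * ((∫⁻ x in ZSpan.fundamentalDomain b, (ENNReal.ofReal (D x))⁻¹ ∂μ).toReal
          / μ.real (ZSpan.fundamentalDomain b)) := by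
  set Q := ZSpan.fundamentalDomain b with hQ
  set I := ∫⁻ x in Q, (ENNReal.ofReal (D x))⁻¹ ∂μ with hI
  have hQfin : μ Q ≠ ⊤ := (ZSpan.fundamentalDomain_isBounded b).measure_lt_top.ne
  have hfinQ : IsFiniteMeasure (μ.restrict Q) := ⟨by simpa using hQfin.lt_top⟩
  have hQ0 : μ.real Q ≠ 0 := by
    simpa [measureReal_def, ENNReal.toReal_eq_zero_iff, hQfin] using
      ZSpan.measure_fundamentalDomain_ne_zero b (μ := μ)
  have hN : (Fintype.card A : ℂ) ≠ 0 := by exact_mod_cast Fintype.card_ne_zero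
  have hN' : (0 : ℝ) < Fintype.card A := by exact_mod_cast Fintype.card_pos
  -- Translating the mesh by `s` and comparing with the unshifted mesh.
  have hpoint : ∀ s, ‖∑ x, (F (pt x + s) - F (pt x))‖ₑ
      ≤ ∑ x, ENNReal.ofReal (C * ρ) * (ENNReal.ofReal (D (pt x + s)))⁻¹ := by
    intro s
    obtain ⟨n, r, hr, h⟩ := hpt s
    have hFs : ∀ x, F (pt x + s) = F (pt (x + n) + r) := fun x => by
      obtain ⟨G, hG, e⟩ := h x
      rw [e, hF G hG]
    have hDs : ∀ x, D (pt x + s) = D (pt (x + n) + r) := fun x => by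
      obtain ⟨G, hG, e⟩ := h x
      rw [e, hD G hG]
    have e1 : ∑ x, (F (pt x + s) - F (pt x)) = ∑ x, (F (pt x + r) - F (pt x)) := by
      rw [Finset.sum_sub_distrib, Finset.sum_sub_distrib]
      congr 1
      simp only [hFs]
      exact Equiv.sum_comp (Equiv.addRight n) (fun x => F (pt x + r))
    have e2 : ∑ x, ENNReal.ofReal (C * ρ) * (ENNReal.ofReal (D (pt x + s)))⁻¹
        = ∑ x, ENNReal.ofReal (C * ρ) * (ENNReal.ofReal (D (pt x + r)))⁻¹ := by
      simp only [hDs]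
      exact Equiv.sum_comp (Equiv.addRight n)
        (fun x => ENNReal.ofReal (C * ρ) * (ENNReal.ofReal (D (pt x + r)))⁻¹)
    rw [e1, e2]
    refine (enorm_sum_le _ _).trans (Finset.sum_le_sum fun x _ => ?_)
    rw [← div_eq_mul_inv, ENNReal.le_div_iff_mul_le (Or.inr (by positivity)) (Or.inl (by simp)),
      ← ofReal_norm, ← ENNReal.ofReal_mul (norm_nonneg _)]
    refine ENNReal.ofReal_le_ofReal ?_
    rw [mul_comm]
    refine (hlip _ _).trans ?_
    rw [add_sub_cancel_left]
    gcongr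
  have hint : ∀ v, Integrable (fun s => F (v + s)) (μ.restrict Q) := fun v => by
    refine Integrable.of_bound ?_ M (Eventually.of_forall fun s => hM _)
    exact (hmeas.comp_measurePreserving (measurePreserving_add_left μ v)).restrict
  have hshift : ∀ v, ∫ s in Q, F (v + s) ∂μ = ∫ s in Q, F s ∂μ := fun v => by
    simpa only [add_comm v] using setIntegral_fundamentalDomain_add_right b μ hF v
  have hshiftD : ∀ v, ∫⁻ s in Q, (ENNReal.ofReal (D (v + s)))⁻¹ ∂μ = I := fun v => by
    simpa only [add_comm v] using setLIntegral_fundamentalDomain_add_right b μ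
      (f := fun x => (ENNReal.ofReal (D x))⁻¹) (fun G hG x => by rw [hD G hG]) v
  have hsum : ∫ s in Q, ∑ x, (F (pt x + s) - F (pt x)) ∂μ
      = (Fintype.card A : ℂ) * ∫ s in Q, F s ∂μ - (μ.real Q : ℂ) * ∑ x, F (pt x) := by
    have hsub : ∀ x ∈ (Finset.univ : Finset A),
        Integrable (fun s => F (pt x + s) - F (pt x)) (μ.restrict Q) :=
      fun x _ => (hint (pt x)).sub (integrable_const _)
    rw [integral_finsetSum _ hsub]
    simp_rw [integral_sub (hint _) (integrable_const _), hshift, Finset.sum_sub_distrib]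
    simp [Finset.mul_sum, measureReal_def]
  have hbound : ‖∫ s in Q, ∑ x, (F (pt x + s) - F (pt x)) ∂μ‖ₑ
      ≤ (Fintype.card A : ℝ≥0∞) * (ENNReal.ofReal (C * ρ) * I) := by
    calc _ ≤ ∫⁻ s in Q, ‖∑ x, (F (pt x + s) - F (pt x))‖ₑ ∂μ := enorm_integral_le_lintegral_enorm _
      _ ≤ ∫⁻ s in Q, ∑ x, ENNReal.ofReal (C * ρ) * (ENNReal.ofReal (D (pt x + s)))⁻¹ ∂μ :=
          lintegral_mono hpoint
      _ = ∑ x : A, ENNReal.ofReal (C * ρ) * I := by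
          rw [lintegral_finsetSum _ fun x _ => by fun_prop]
          refine Finset.sum_congr rfl fun x _ => ?_
          rw [lintegral_const_mul _ (by fun_prop), hshiftD]
      _ = _ := by simp
  have hreal : ‖∫ s in Q, ∑ x, (F (pt x + s) - F (pt x)) ∂μ‖
      ≤ Fintype.card A * (C * ρ * I.toReal) := by
    have := ENNReal.toReal_mono (by finiteness) hbound
    simpa [ENNReal.toReal_mul, ENNReal.toReal_ofReal (mul_pos hC hρ).le] using this
  have heq : (⨍ x in Q, F x ∂μ) - (1 / (Fintype.card A : ℂ)) * ∑ x, F (pt x)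
      = (∫ s in Q, ∑ x, (F (pt x + s) - F (pt x)) ∂μ) / ((Fintype.card A : ℂ) * μ.real Q) := by
    rw [hsum, setAverage_eq, Complex.real_smul]
    have : (μ.real Q : ℂ) ≠ 0 := by exact_mod_cast hQ0
    push_cast
    field_simp
  rw [heq, norm_div, norm_mul, Complex.norm_natCast, Complex.norm_real, Real.norm_of_nonneg
    measureReal_nonneg, div_le_iff₀ (by positivity)]
  refine hreal.trans (le_of_eq ?_)
  field_simp

end Quadrature

/-! ### Periodic functions of three momenta with mild singularities -/

section MildSingularity

variable (b : Module.Basis (Fin 3) ℝ E)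

/-- The distance of `p = (k_i, k_j, k_a)` from the set where one of the momentum transfers
`k_a - k_i` and `k_b - k_i = k_j - k_a` is a lattice vector. -/
def transferDist (p : E × E × E) : ℝ :=
  min (latticeDist b (p.2.2 - p.1)) (latticeDist b (p.2.1 - p.2.2))

/-- Bounded functions of `(k_i, k_j, k_a)`, periodic in each variable, whose first derivatives
diverge at most like the inverse distance to the set of singular momentum transfers. The last
property is expressed by difference quotients. -/
structure IsMildlySingular (F : E × E × E → ℂ) : Prop where
  periodic : ∀ p g : E × E × E, g.1 ∈ lattice b → g.2.1 ∈ lattice b → g.2.2 ∈ lattice b →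
    F (p + g) = F p
  bounded : ∃ M, ∀ p, ‖F p‖ ≤ M
  lipschitz : ∃ C, ∀ p p', transferDist b p * ‖F p - F p'‖ ≤ C * ‖p - p'‖

variable {b}

theorem transferDist_nonneg (p : E × E × E) : 0 ≤ transferDist b p :=
  le_min (latticeDist_nonneg b _) (latticeDist_nonneg b _)

theorem continuous_transferDist : Continuous (transferDist b) :=
  ((continuous_latticeDist b).comp (by fun_prop)).min ((continuous_latticeDist b).comp (by fun_prop))

theorem transferDist_add (p g : E × E × E) (h1 : g.1 ∈ lattice b) (h2 : g.2.1 ∈ lattice b)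
    (h3 : g.2.2 ∈ lattice b) : transferDist b (p + g) = transferDist b p := by
  simp only [transferDist, Prod.fst_add, Prod.snd_add, add_sub_add_comm]
  rw [latticeDist_add b (sub_mem h3 h1), latticeDist_add b (sub_mem h2 h3)]

namespace IsMildlySingular

theorem const (c : ℂ) : IsMildlySingular b fun _ => c :=
  ⟨fun _ _ _ _ _ => rfl, ⟨‖c‖, fun _ => le_rfl⟩, ⟨0, fun p p' => by simp⟩⟩

theorem add {F F' : E × E × E → ℂ} (h : IsMildlySingular b F) (h' : IsMildlySingular b F') :
    IsMildlySingular b fun p => F p + F' p := by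
  obtain ⟨M, hM⟩ := h.bounded
  obtain ⟨M', hM'⟩ := h'.bounded
  obtain ⟨C, hC⟩ := h.lipschitz
  obtain ⟨C', hC'⟩ := h'.lipschitz
  refine ⟨fun p g h1 h2 h3 => by rw [h.periodic p g h1 h2 h3, h'.periodic p g h1 h2 h3],
    ⟨M + M', fun p => (norm_add_le _ _).trans (add_le_add (hM p) (hM' p))⟩,
    ⟨C + C', fun p p' => ?_⟩⟩
  have h1 : ‖F p + F' p - (F p' + F' p')‖ ≤ ‖F p - F p'‖ + ‖F' p - F' p'‖ := by
    rw [add_sub_add_comm]; exact norm_add_le _ _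
  nlinarith [mul_le_mul_of_nonneg_left h1 (transferDist_nonneg (b := b) p), hC p p', hC' p p']

theorem mul {F F' : E × E × E → ℂ} (h : IsMildlySingular b F) (h' : IsMildlySingular b F') :
    IsMildlySingular b fun p => F p * F' p := by
  obtain ⟨M, hM⟩ := h.bounded
  obtain ⟨M', hM'⟩ := h'.bounded
  obtain ⟨C, hC⟩ := h.lipschitz
  obtain ⟨C', hC'⟩ := h'.lipschitz
  have hM0 : 0 ≤ M := (norm_nonneg _).trans (hM 0)
  have hM0' : 0 ≤ M' := (norm_nonneg _).trans (hM' 0)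
  refine ⟨fun p g h1 h2 h3 => by rw [h.periodic p g h1 h2 h3, h'.periodic p g h1 h2 h3],
    ⟨M * M', fun p => by rw [norm_mul]; exact mul_le_mul (hM p) (hM' p) (norm_nonneg _) hM0⟩,
    ⟨M' * C + M * C', fun p p' => ?_⟩⟩
  have hd := transferDist_nonneg (b := b) p
  have h1 : ‖F p * F' p - F p' * F' p'‖ ≤ ‖F p - F p'‖ * M' + M * ‖F' p - F' p'‖ := by
    have e : F p * F' p - F p' * F' p' = (F p - F p') * F' p + F p' * (F' p - F' p') := by ring
    rw [e]
    refine (norm_add_le _ _).trans ?_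
    rw [norm_mul, norm_mul]
    gcongr
    · exact hM' p
    · exact hM p'
  calc _ ≤ transferDist b p * (‖F p - F p'‖ * M' + M * ‖F' p - F' p'‖) := by gcongr
    _ = M' * (transferDist b p * ‖F p - F p'‖) + M * (transferDist b p * ‖F' p - F' p'‖) := by ring
    _ ≤ M' * (C * ‖p - p'‖) + M * (C' * ‖p - p'‖) := by
      exact add_le_add (mul_le_mul_of_nonneg_left (hC p p') hM0')
        (mul_le_mul_of_nonneg_left (hC' p p') hM0)
    _ = _ := by ring

theorem sub {F F' : E × E × E → ℂ} (h : IsMildlySingular b F) (h' : IsMildlySingular b F') :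
    IsMildlySingular b fun p => F p - F' p := by
  simpa [sub_eq_add_neg] using h.add ((const (-1)).mul h')

theorem sum {α : Type*} (s : Finset α) {F : α → E × E × E → ℂ}
    (h : ∀ i, IsMildlySingular b (F i)) : IsMildlySingular b fun p => ∑ i ∈ s, F i p := by
  classical
  induction s using Finset.induction_on with
  | empty => simpa using const 0
  | insert i s hi ih => simpa [Finset.sum_insert hi] using (h i).add ih

end IsMildlySingular

instance isAddHaarMeasure_volume_pair : (volume : Measure (E × E)).IsAddHaarMeasure :=
  Measure.prod.instIsAddHaarMeasure _ _

instance isAddHaarMeasure_volume_triple : (volume : Measure (E × E × E)).IsAddHaarMeasure :=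
  Measure.prod.instIsAddHaarMeasure _ _

/-- The basis of `E × E × E` that generates the lattice of triples of lattice vectors. -/
def tripleBasis (b : Module.Basis (Fin 3) ℝ E) :
    Module.Basis (Fin 3 ⊕ (Fin 3 ⊕ Fin 3)) ℝ (E × E × E) :=
  b.prod (b.prod b)

theorem fundamentalDomain_tripleBasis : ZSpan.fundamentalDomain (tripleBasis b)
    = ZSpan.fundamentalDomain b ×ˢ ZSpan.fundamentalDomain b ×ˢ ZSpan.fundamentalDomain b := by
  ext p
  simp [ZSpan.mem_fundamentalDomain, tripleBasis, Set.mem_prod, Sum.forall, Module.Basis.prod]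

theorem mem_span_tripleBasis {g : E × E × E} :
    g ∈ Submodule.span ℤ (Set.range (tripleBasis b)) ↔
      g.1 ∈ lattice b ∧ g.2.1 ∈ lattice b ∧ g.2.2 ∈ lattice b := by
  simp only [Module.Basis.mem_span_iff_repr_mem, tripleBasis, Sum.forall, Module.Basis.prod_repr_inl,
    Module.Basis.prod_repr_inr]

theorem lintegral_inv_transferDist_lt_top :
    ∫⁻ p in ZSpan.fundamentalDomain (tripleBasis b), (ENNReal.ofReal (transferDist b p))⁻¹ < ⊤ := by
  set Q := ZSpan.fundamentalDomain b with hQ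
  set I := ∫⁻ q in Q, (ENNReal.ofReal (latticeDist b q))⁻¹ with hI
  have hmeas : Measurable (latticeDist b) := (continuous_latticeDist b).measurable
  have hshift : ∀ k, ∫⁻ q in Q, (ENNReal.ofReal (latticeDist b (q - k)))⁻¹ = I := fun k => by
    simpa only [sub_eq_add_neg] using setLIntegral_fundamentalDomain_add_right b volume
      (f := fun x => (ENNReal.ofReal (latticeDist b x))⁻¹)
      (fun G hG x => by rw [latticeDist_add b hG]) (-k)
  have hle : ∀ p : E × E × E, (ENNReal.ofReal (transferDist b p))⁻¹
      ≤ (ENNReal.ofReal (latticeDist b (p.2.2 - p.1)))⁻¹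
        + (ENNReal.ofReal (latticeDist b (p.2.2 - p.2.1)))⁻¹ := by
    intro p
    have e : latticeDist b (p.2.2 - p.2.1) = latticeDist b (p.2.1 - p.2.2) := by
      rw [← neg_sub, latticeDist_neg]
    rw [e, transferDist]
    rcases min_choice (latticeDist b (p.2.2 - p.1)) (latticeDist b (p.2.1 - p.2.2)) with h | h <;>
      rw [h]
    · exact le_self_add
    · exact le_add_self
  have hm1 : Measurable fun p : E × E × E => (ENNReal.ofReal (latticeDist b (p.2.2 - p.1)))⁻¹ := by
    fun_prop
  have hm2 : Measurable fun p : E × E × E => (ENNReal.ofReal (latticeDist b (p.2.2 - p.2.1)))⁻¹ := by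
    fun_prop
  refine lt_of_le_of_lt (lintegral_mono hle) ?_
  rw [lintegral_add_left hm1, fundamentalDomain_tripleBasis, ← hQ,
    Measure.volume_eq_prod E (E × E), ← Measure.prod_restrict, lintegral_prod _ hm1.aemeasurable,
    lintegral_prod _ hm2.aemeasurable, Measure.volume_eq_prod E E, ← Measure.prod_restrict]
  have hI' : I < ⊤ := lintegral_inv_latticeDist_lt_top b
  have hQ' : volume Q < ⊤ := volume_fundamentalDomain_lt_top b
  have h1 : ∀ x : E, ∫⁻ y : E × E, (ENNReal.ofReal (latticeDist b (y.2 - x)))⁻¹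
      ∂((volume.restrict Q).prod (volume.restrict Q)) = I * volume Q := fun x => by
    rw [lintegral_prod _ (by fun_prop)]
    simp [hshift]
  have h2 : ∫⁻ y : E × E, (ENNReal.ofReal (latticeDist b (y.2 - y.1)))⁻¹
      ∂((volume.restrict Q).prod (volume.restrict Q)) = I * volume Q := by
    rw [lintegral_prod _ (by fun_prop)]
    simp [hshift]
  simp only [h1, h2, lintegral_const, Measure.restrict_apply MeasurableSet.univ, Set.univ_inter]
  finiteness

theorem IsMildlySingular.aestronglyMeasurable {F : E × E × E → ℂ} (h : IsMildlySingular b F) :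
    AEStronglyMeasurable F := by
  obtain ⟨C, hC⟩ := h.lipschitz
  -- The singular set is a countable union of lower-dimensional sets, hence null.
  have hnull : ∀ᵐ p : E × E × E, 0 < transferDist b p := by
    have hlat : ∀ᵐ q : E, q ∈ (lattice b : Set E)ᶜ :=
      (Set.countable_coe_iff.mp (inferInstanceAs (Countable (lattice b)))).ae_notMem volume
    have hae : ∀ φ : E × E × E →ₗ[ℝ] E, Function.Surjective φ → ∀ᵐ p, φ p ∉ lattice b :=
      fun φ hφ => (ae_comp_linearMap_mem_iff φ volume volume hφ
        (isClosed_lattice b).isOpen_compl.measurableSet).mpr hlat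
    filter_upwards [
      hae (LinearMap.snd ℝ E E ∘ₗ LinearMap.snd ℝ E (E × E) - LinearMap.fst ℝ E (E × E))
        (fun q => ⟨(-q, 0, 0), by simp⟩),
      hae ((LinearMap.fst ℝ E E - LinearMap.snd ℝ E E) ∘ₗ LinearMap.snd ℝ E (E × E))
        (fun q => ⟨(0, q, 0), by simp⟩)] with p h1 h2
    exact lt_min ((latticeDist_pos_iff b).mpr h1) ((latticeDist_pos_iff b).mpr h2)
  have hopen : IsOpen {p : E × E × E | 0 < transferDist b p} :=
    isOpen_lt continuous_const continuous_transferDist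
  have hcont : ContinuousOn F {p | 0 < transferDist b p} := by
    intro p hp
    refine ContinuousAt.continuousWithinAt ?_
    rw [ContinuousAt, tendsto_iff_norm_sub_tendsto_zero]
    have hlim : Tendsto (fun p' => C * ‖p - p'‖ / transferDist b p) (nhds p) (nhds 0) := by
      have : Continuous fun p' => C * ‖p - p'‖ / transferDist b p := by fun_prop
      simpa using this.tendsto p
    refine squeeze_zero (fun _ => norm_nonneg _) (fun p' => ?_) hlim
    rw [le_div_iff₀ hp, norm_sub_rev, mul_comm]
    exact hC p p'
  have := hcont.aestronglyMeasurable hopen.measurableSet (μ := volume)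
  rwa [Measure.restrict_eq_self_of_ae_mem (s := {p | 0 < transferDist b p}) hnull] at this

end MildSingularity

/-! ### Uniform meshes of the Brillouin zone -/

section Mesh

variable {nocc nvir : ℕ} (S : PeriodicSystem nocc nvir)

/-- Up to reciprocal lattice vectors, translating a uniform mesh by `s` amounts to relabelling its
points and translating by a vector shorter than a cell of the mesh. -/
theorem exists_meshPoint_add_eq (k₀ : E) (m : ℕ+) (s : E) :
    ∃ (n : MeshIndex m) (r : E), ‖r‖ ≤ (∑ i, ‖recipBasis S.prim i‖) / (m : ℝ) ∧
      ∀ x, ∃ G ∈ S.recipLattice,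
        S.meshPoint k₀ m x + s = S.meshPoint k₀ m (x + n) + r + G := by
  set b := recipBasis S.prim with hb
  have hm : (m : ℝ) ≠ 0 := by exact_mod_cast m.ne_zero
  set z : Fin 3 → ℤ := fun i => ⌊b.repr ((m : ℝ) • s) i⌋ with hz
  set r : E := (m : ℝ)⁻¹ • ZSpan.fract b ((m : ℝ) • s) with hr
  refine ⟨fun i => (z i : ZMod m), r, ?_, fun x => ?_⟩
  · rw [hr, norm_smul, norm_inv, Real.norm_natCast, div_eq_inv_mul]
    gcongr
    exact ZSpan.norm_fract_le b _
  have hs : s = ∑ i, ((z i : ℝ) / m) • b i + r := by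
    have h1 : (m : ℝ) • s = ∑ i, (z i : ℝ) • b i + ZSpan.fract b ((m : ℝ) • s) := by
      rw [ZSpan.fract_apply, ZSpan.floor]
      simp [hz, ← Int.cast_smul_eq_zsmul ℝ]
    have h2 : s = (m : ℝ)⁻¹ • ((m : ℝ) • s) := by rw [inv_smul_smul₀ hm]
    rw [h2, h1, smul_add, Finset.smul_sum, hr]
    congr 1
    refine Finset.sum_congr rfl fun i _ => ?_
    rw [smul_smul, div_eq_inv_mul]
  -- The relabelled index and the translated point agree modulo the period `m` of the mesh.
  have hdvd : ∀ i, ∃ w : ℤ, ((x i).val : ℤ) + z i - ((x i + (z i : ZMod m)).val : ℤ) = m * w := by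
    intro i
    have h : (((x i).val : ℤ) + z i - ((x i + (z i : ZMod m)).val : ℤ) : ℤ) = (0 : ZMod m) := by
      push_cast
      simp
    exact (ZMod.intCast_zmod_eq_zero_iff_dvd _ _).mp h
  choose w hw using hdvd
  refine ⟨∑ i, w i • b i, Submodule.sum_mem _ fun i _ =>
    Submodule.smul_mem _ _ (Submodule.subset_span ⟨i, rfl⟩), ?_⟩
  have hw' : ∀ i, ((x i).val : ℝ) / m + (z i : ℝ) / m
      = (((x i + (z i : ZMod m)).val : ℝ)) / m + w i := by
    intro i
    have := congrArg (fun t : ℤ => (t : ℝ)) (hw i)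
    push_cast at this
    field_simp
    linarith
  have hsum : ∑ i, (((x i).val : ℝ) / m) • b i + ∑ i, ((z i : ℝ) / m) • b i
      = ∑ i, (((x i + (z i : ZMod m)).val : ℝ) / m) • b i + ∑ i, w i • b i := by
    rw [← Finset.sum_add_distrib, ← Finset.sum_add_distrib]
    refine Finset.sum_congr rfl fun i _ => ?_
    rw [← add_smul, hw', add_smul, Int.cast_smul_eq_zsmul]
  rw [hs, PeriodicSystem.meshPoint, PeriodicSystem.meshPoint]
  have : ∀ a b' c d e : E, b' + c = d + e → a + b' + (c + r) = a + d + r + e := by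
    intro a b' c d e h
    have : a + b' + (c + r) = a + (b' + c) + r := by abel
    rw [this, h]; abel
  exact this _ _ _ _ _ hsum

theorem card_meshIndex (m : ℕ+) : Fintype.card (MeshIndex m) = Nk m := by
  simp [MeshIndex, Nk, ZMod.card]

theorem Nk_rpow (m : ℕ+) : (Nk m : ℝ) ^ (-(1 / 3) : ℝ) = 1 / (m : ℝ) := by
  have hm : (0 : ℝ) < m := by exact_mod_cast m.pos
  rw [Nk, Nat.cast_pow, ← Real.rpow_natCast, ← Real.rpow_mul hm.le]
  norm_num [Real.rpow_neg_one]

/-- Quadrature of mildly singular functions on uniform meshes has error `O(1/m)`, uniformly in the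
offset of the mesh. -/
theorem IsMildlySingular.exists_norm_average_sub_le {F : E × E × E → ℂ}
    (h : IsMildlySingular (recipBasis S.prim) F) :
    ∃ C : ℝ, ∀ (k₀ : E) (m : ℕ+),
      ‖(⨍ p in S.brillouinZone ×ˢ S.brillouinZone ×ˢ S.brillouinZone, F p)
        - (1 / (Nk m : ℂ) ^ 3) * ∑ x, ∑ y, ∑ z,
          F (S.meshPoint k₀ m x, S.meshPoint k₀ m y, S.meshPoint k₀ m z)‖ ≤ C * (1 / (m : ℝ)) := by
  set b := recipBasis S.prim with hb
  obtain ⟨M, hM⟩ := h.bounded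
  obtain ⟨C, hC⟩ := h.lipschitz
  set R := ∑ i, ‖b i‖ + 1 with hR
  have hR0 : 0 < R := by positivity
  refine ⟨max C 1 * R * ((∫⁻ x in ZSpan.fundamentalDomain (tripleBasis b),
    (ENNReal.ofReal (transferDist b x))⁻¹).toReal
      / volume.real (ZSpan.fundamentalDomain (tripleBasis b))), fun k₀ m => ?_⟩
  have hm : (0 : ℝ) < m := by exact_mod_cast m.pos
  have key := norm_average_sub_mesh_average_le (A := MeshIndex m × MeshIndex m × MeshIndex m)
    (tripleBasis b) volume
    (fun x => (S.meshPoint k₀ m x.1, S.meshPoint k₀ m x.2.1, S.meshPoint k₀ m x.2.2))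
    (ρ := R / m) (by positivity) ?_ (F := F) (M := M) (D := transferDist b) (C := max C 1)
    (fun G hG x => ?_) h.aestronglyMeasurable hM (fun G hG x => ?_)
    continuous_transferDist.measurable (by positivity)
    (fun x y => (hC x y).trans (by gcongr; exact le_max_left _ _))
    lintegral_inv_transferDist_lt_top
  · rw [fundamentalDomain_tripleBasis] at key ⊢
    have hcard : (Fintype.card (MeshIndex m × MeshIndex m × MeshIndex m) : ℂ) = (Nk m : ℂ) ^ 3 := by
      rw [Fintype.card_prod, Fintype.card_prod, card_meshIndex]
      push_cast; ring
    rw [hcard, Fintype.sum_prod_type] at key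
    simp only [Fintype.sum_prod_type] at key
    refine key.trans (le_of_eq ?_)
    ring
  · intro s
    obtain ⟨n₁, r₁, hr₁, h₁⟩ := exists_meshPoint_add_eq S k₀ m s.1
    obtain ⟨n₂, r₂, hr₂, h₂⟩ := exists_meshPoint_add_eq S k₀ m s.2.1
    obtain ⟨n₃, r₃, hr₃, h₃⟩ := exists_meshPoint_add_eq S k₀ m s.2.2
    have hle : (∑ i, ‖b i‖) / (m : ℝ) ≤ R / m := by gcongr; linarith
    refine ⟨(n₁, n₂, n₃), (r₁, r₂, r₃), ?_, fun x => ?_⟩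
    · exact norm_prod_le_iff.mpr ⟨hr₁.trans hle,
        norm_prod_le_iff.mpr ⟨hr₂.trans hle, hr₃.trans hle⟩⟩
    · obtain ⟨G₁, hG₁, e₁⟩ := h₁ x.1
      obtain ⟨G₂, hG₂, e₂⟩ := h₂ x.2.1
      obtain ⟨G₃, hG₃, e₃⟩ := h₃ x.2.2
      exact ⟨(G₁, G₂, G₃), mem_span_tripleBasis.mpr ⟨hG₁, hG₂, hG₃⟩,
        Prod.ext e₁ (Prod.ext e₂ e₃)⟩
  · obtain ⟨h1, h2, h3⟩ := mem_span_tripleBasis.mp hG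
    exact h.periodic x G h1 h2 h3
  · obtain ⟨h1, h2, h3⟩ := mem_span_tripleBasis.mp hG
    exact transferDist_add x G h1 h2 h3

end Mesh

/-! ### Square summable families -/

section SquareSummable

variable {ι : Type*}

/-- The family `f` has `ℓ²` norm at most `A`. -/
def HasL2Bound (f : ι → ℂ) (A : ℝ) : Prop :=
  0 ≤ A ∧ ∀ s : Finset ι, ∑ i ∈ s, ‖f i‖ ^ 2 ≤ A ^ 2

theorem HasL2Bound.sum_norm_mul_le {f g : ι → ℂ} {A B : ℝ} (hf : HasL2Bound f A)
    (hg : HasL2Bound g B) (s : Finset ι) : ∑ i ∈ s, ‖f i * g i‖ ≤ A * B := by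
  refine abs_le_of_sq_le_sq' ?_ (mul_nonneg hf.1 hg.1) |>.2
  simp only [norm_mul]
  refine (Finset.sum_mul_sq_le_sq_mul_sq s _ _).trans ?_
  rw [mul_pow]
  exact mul_le_mul (hf.2 s) (hg.2 s) (Finset.sum_nonneg fun _ _ => by positivity) (by positivity)

theorem HasL2Bound.summable_mul {f g : ι → ℂ} {A B : ℝ} (hf : HasL2Bound f A)
    (hg : HasL2Bound g B) : Summable fun i => f i * g i :=
  Summable.of_norm (summable_of_sum_le (fun _ => norm_nonneg _) (hf.sum_norm_mul_le hg))

theorem HasL2Bound.norm_tsum_mul_le {f g : ι → ℂ} {A B : ℝ} (hf : HasL2Bound f A)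
    (hg : HasL2Bound g B) : ‖∑' i, f i * g i‖ ≤ A * B :=
  (norm_tsum_le_tsum_norm (hf.summable_mul hg).norm).trans
    (Real.tsum_le_of_sum_le (fun _ => norm_nonneg _) (hf.sum_norm_mul_le hg))

theorem HasL2Bound.comp_equiv {κ : Type*} {f : ι → ℂ} {A : ℝ} (hf : HasL2Bound f A)
    (e : κ ≃ ι) : HasL2Bound (fun i => f (e i)) A :=
  ⟨hf.1, fun s => by simpa using hf.2 (s.map e.toEmbedding)⟩

end SquareSummable

/-! ### Fourier coefficients on the unit cell -/

section Fourier

variable {nocc nvir : ℕ} (S : PeriodicSystem nocc nvir)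

/-- The plane wave `exp(i G·r)`. -/
def planeWave (G : E) : E →ᵇ ℂ :=
  BoundedContinuousFunction.ofNormedAddCommGroup
    (fun r => Complex.exp (Complex.I * (inner ℝ G r : ℝ))) (by fun_prop) 1 (fun r => by
      rw [mul_comm, Complex.norm_exp_ofReal_mul_I])

theorem planeWave_apply (G r : E) :
    planeWave G r = Complex.exp (Complex.I * (inner ℝ G r : ℝ)) := rfl

theorem planeWave_add_right (G r s : E) :
    planeWave G (r + s) = planeWave G r * planeWave G s := by
  simp only [planeWave_apply, ← Complex.exp_add, inner_add_right]
  push_cast; ring_nf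

theorem planeWave_add_left (G H r : E) :
    planeWave (G + H) r = planeWave G r * planeWave H r := by
  simp only [planeWave_apply, ← Complex.exp_add, inner_add_left]
  push_cast; ring_nf

theorem conj_planeWave (G r : E) : (starRingEnd ℂ) (planeWave G r) = planeWave (-G) r := by
  simp only [planeWave_apply, ← Complex.exp_conj, map_mul, Complex.conj_I, Complex.conj_ofReal,
    inner_neg_left]
  push_cast; ring_nf

theorem norm_planeWave (G r : E) : ‖planeWave G r‖ = 1 := by
  rw [planeWave_apply, mul_comm, Complex.norm_exp_ofReal_mul_I]

theorem exp_neg_eq_planeWave (G r : E) :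
    Complex.exp (-(Complex.I * (inner ℝ G r : ℝ))) = planeWave (-G) r := by
  rw [planeWave_apply, inner_neg_left]
  push_cast; ring_nf

theorem planeWave_zero (r : E) : planeWave 0 r = 1 := by simp [planeWave_apply]

theorem planeWave_eq_one {G R : E} (hG : G ∈ S.recipLattice) (hR : R ∈ lattice S.prim) :
    planeWave G R = 1 := by
  induction hR using Submodule.span_induction with
  | mem x hx =>
    obtain ⟨j, rfl⟩ := hx
    induction hG using Submodule.span_induction with
    | mem y hy =>
      obtain ⟨i, rfl⟩ := hy
      rw [planeWave_apply, inner_recipBasis]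
      split_ifs
      · rw [mul_comm]; push_cast; exact Complex.exp_two_pi_mul_I
      · simp
    | zero => exact planeWave_zero _
    | add y z _ _ hy hz => rw [planeWave_add_left, hy, hz, one_mul]
    | smul n y _ hy =>
      rw [planeWave_apply] at hy ⊢
      rw [← Int.cast_smul_eq_zsmul ℝ, inner_smul_left]
      have : Complex.I * ((starRingEnd ℝ) (n : ℝ) * inner ℝ y (S.prim j) : ℝ)
          = n * (Complex.I * (inner ℝ y (S.prim j) : ℝ)) := by
        simp; ring
      rw [this, Complex.exp_int_mul, hy, one_zpow]
  | zero => simp [planeWave_apply]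
  | add y z _ _ hy hz => rw [planeWave_add_right, hy, hz, one_mul]
  | smul n y _ hy =>
    rw [planeWave_apply] at hy ⊢
    rw [← Int.cast_smul_eq_zsmul ℝ, inner_smul_right]
    have : Complex.I * ((n : ℝ) * inner ℝ G y : ℝ) = n * (Complex.I * (inner ℝ G y : ℝ)) := by
      push_cast; ring
    rw [this, Complex.exp_int_mul, hy, one_zpow]

/-- The volume of the unit cell. -/
def cellVolume : ℝ := volume.real S.cell

instance isFiniteMeasure_restrict_cell : IsFiniteMeasure (volume.restrict S.cell) :=
  ⟨by
    rw [Measure.restrict_apply_univ]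
    exact volume_fundamentalDomain_lt_top S.prim⟩

theorem cellVolume_pos : 0 < cellVolume S :=
  ENNReal.toReal_pos (ZSpan.measure_fundamentalDomain_ne_zero S.prim)
    (volume_fundamentalDomain_lt_top S.prim).ne

/-- Translating by a half period multiplies a nonconstant plane wave by `-1`. -/
theorem integral_planeWave_eq_zero {G : E} (hG : G ∈ S.recipLattice) (hG0 : G ≠ 0) :
    ∫ r in S.cell, planeWave G r = 0 := by
  have h := setIntegral_fundamentalDomain_add_right S.prim volume (f := planeWave G)
    (fun R hR r => by rw [planeWave_add_right, planeWave_eq_one S hG hR, mul_one])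
    ((Real.pi / ‖G‖ ^ 2) • G)
  have hv : planeWave G ((Real.pi / ‖G‖ ^ 2) • G) = -1 := by
    have : ‖G‖ ≠ 0 := norm_ne_zero_iff.mpr hG0
    rw [planeWave_apply, inner_smul_right, real_inner_self_eq_norm_sq,
      div_mul_cancel₀ _ (by positivity), mul_comm, Complex.exp_pi_mul_I]
  simp only [planeWave_add_right, hv, mul_neg, mul_one, integral_neg] at h
  change ∫ r in ZSpan.fundamentalDomain S.prim, planeWave G r = 0
  exact self_eq_neg.mp h.symm

/-- The integral `∫_Ω exp(-i G·r) g(r) dr`. -/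
def fourierIntegral (g : E →ᵇ ℂ) (G : E) : ℂ := ∫ r in S.cell, planeWave (-G) r * g r

theorem norm_fourierIntegral_le (g : E →ᵇ ℂ) (G : E) :
    ‖fourierIntegral S g G‖ ≤ ‖g‖ * cellVolume S := by
  refine norm_setIntegral_le_of_norm_le_const (volume_fundamentalDomain_lt_top S.prim) fun r _ => ?_
  rw [norm_mul, norm_planeWave, one_mul]
  exact g.norm_coe_le_norm r

theorem fourierIntegral_sub (g h : E →ᵇ ℂ) (G : E) :
    fourierIntegral S (g - h) G = fourierIntegral S g G - fourierIntegral S h G := by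
  refine Eq.trans (integral_congr_ae (Eventually.of_forall fun r => ?_))
    (integral_sub ((planeWave (-G) * g).integrable _) ((planeWave (-G) * h).integrable _))
  simp [mul_sub]

/-- Bessel's inequality. -/
theorem hasL2Bound_fourierIntegral (g : E →ᵇ ℂ) :
    HasL2Bound (fun G : S.recipLattice => fourierIntegral S g G) (‖g‖ * cellVolume S) := by
  have hvol := cellVolume_pos S
  refine ⟨by positivity, fun s => ?_⟩
  set μ := volume.restrict S.cell with hμ
  set c : ℂ := (((√(cellVolume S))⁻¹ : ℝ) : ℂ) with hc
  have hcc : c * c * cellVolume S = 1 := by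
    rw [hc]; norm_cast
    rw [← mul_inv, Real.mul_self_sqrt hvol.le, inv_mul_cancel₀ hvol.ne']
  have hcn : ‖c‖ ^ 2 * cellVolume S = 1 := by
    rw [hc, Complex.norm_real, Real.norm_of_nonneg (by positivity), inv_pow, Real.sq_sqrt hvol.le,
      inv_mul_cancel₀ hvol.ne']
  have hconj : (starRingEnd ℂ) c = c := Complex.conj_ofReal _
  -- The normalized plane waves are orthonormal in `L²` of the unit cell.
  let L := BoundedContinuousFunction.toLp (α := E) (E := ℂ) 2 μ ℂ
  let e : S.recipLattice → Lp ℂ 2 μ := fun G => c • L (planeWave G)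
  have horth : Orthonormal ℂ e := by
    rw [orthonormal_iff_ite]
    intro G H
    have h1 : inner ℂ (e G) (e H) = c * c * ∫ r in S.cell, planeWave ((H : E) - G) r := by
      simp only [e, L, inner_smul_left, inner_smul_right, BoundedContinuousFunction.inner_toLp, hconj,
        conj_planeWave, ← planeWave_add_left, ← sub_eq_add_neg, mul_assoc]
      rfl
    rw [h1]
    split_ifs with h
    · simp only [h, sub_self, planeWave_zero]
      have hone : ∫ _ in S.cell, (1 : ℂ) = cellVolume S := by simp [cellVolume]
      rw [hone, hcc]
    · rw [integral_planeWave_eq_zero S (sub_mem H.2 G.2), mul_zero]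
      exact fun h' => h (Subtype.ext (sub_eq_zero.mp h')).symm
  have hcoef : ∀ G : S.recipLattice, inner ℂ (e G) (L g) = c * fourierIntegral S g G := by
    intro G
    simp only [e, L, inner_smul_left, BoundedContinuousFunction.inner_toLp, hconj, conj_planeWave,
      fourierIntegral]
    simp only [mul_comm (planeWave _ _), hμ]
  have hnorm : ‖L g‖ ^ 2 ≤ ‖g‖ ^ 2 * cellVolume S := by
    have h1 : ((‖L g‖ ^ 2 : ℝ) : ℂ) = ∫ r in S.cell, g r * (starRingEnd ℂ) (g r) := by
      rw [← BoundedContinuousFunction.inner_toLp (𝕜 := ℂ), inner_self_eq_norm_sq_to_K]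
      push_cast
      rfl
    have h2 : ‖∫ r in S.cell, g r * (starRingEnd ℂ) (g r)‖ ≤ ‖g‖ ^ 2 * cellVolume S := by
      refine norm_setIntegral_le_of_norm_le_const (volume_fundamentalDomain_lt_top S.prim)
        fun r _ => ?_
      rw [norm_mul, RCLike.norm_conj, sq]
      exact mul_le_mul (g.norm_coe_le_norm r) (g.norm_coe_le_norm r) (norm_nonneg _) (norm_nonneg _)
    rwa [← h1, Complex.norm_real, Real.norm_of_nonneg (by positivity)] at h2
  have hB := horth.sum_inner_products_le (L g) (s := s)
  simp only [hcoef, norm_mul, mul_pow, ← Finset.mul_sum] at hB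
  calc ∑ G ∈ s, ‖fourierIntegral S g G‖ ^ 2
      = cellVolume S * (‖c‖ ^ 2 * ∑ G ∈ s, ‖fourierIntegral S g G‖ ^ 2) := by
        rw [← mul_assoc, mul_comm (cellVolume S), hcn, one_mul]
    _ ≤ cellVolume S * (‖g‖ ^ 2 * cellVolume S) := mul_le_mul_of_nonneg_left (hB.trans hnorm) hvol.le
    _ = _ := by ring

end Fourier

/-! ### Uniform bounds for the orbitals -/

section Orbitals

variable {nocc nvir : ℕ} (S : PeriodicSystem nocc nvir)

theorem u_add (n : Band nocc nvir) (k : E) {G : E} (hG : G ∈ S.recipLattice) (r : E) :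
    S.u n (k + G) r = planeWave (-G) r * S.u n k r := by
  rw [S.gauge n k G hG r, exp_neg_eq_planeWave]

theorem norm_u_sub_u_le_add (n : Band nocc nvir) (k k' : E) {G : E} (hG : G ∈ S.recipLattice) :
    ‖S.u n k - S.u n k'‖ ≤ ‖S.u n (k + G) - S.u n (k' + G)‖ := by
  refine (BoundedContinuousFunction.norm_le (norm_nonneg _)).mpr fun r => ?_
  refine le_trans (le_of_eq ?_)
    (BoundedContinuousFunction.norm_coe_le_norm (S.u n (k + G) - S.u n (k' + G)) r)
  rw [BoundedContinuousFunction.sub_apply, BoundedContinuousFunction.sub_apply, u_add S n k hG,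
    u_add S n k' hG, ← mul_sub, norm_mul, norm_planeWave, one_mul]

theorem norm_u_le_add (n : Band nocc nvir) (k : E) {G : E} (hG : G ∈ S.recipLattice) :
    ‖S.u n k‖ ≤ ‖S.u n (k + G)‖ := by
  refine (BoundedContinuousFunction.norm_le (norm_nonneg _)).mpr fun r => ?_
  refine le_trans (le_of_eq ?_) (BoundedContinuousFunction.norm_coe_le_norm (S.u n (k + G)) r)
  rw [u_add S n k hG, norm_mul, norm_planeWave, one_mul]

/-- The orbitals are bounded and Lipschitz continuous in `k`, uniformly on momentum space. -/
theorem exists_norm_u_le : ∃ M : ℝ, 0 < M ∧ (∀ n k, ‖S.u n k‖ ≤ M) ∧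
    ∀ n k k', ‖S.u n k - S.u n k'‖ ≤ M * ‖k - k'‖ := by
  obtain ⟨R, hR0, hR⟩ := exists_norm_le_of_mem_fundamentalDomain (recipBasis S.prim)
  have hK : IsCompact (Metric.closedBall (0 : E) (R + 1)) := isCompact_closedBall _ _
  have h1 : ∀ n, ∃ M : ℝ, 0 ≤ M ∧ ∀ k, ‖S.u n k‖ ≤ M := by
    intro n
    obtain ⟨M, hM⟩ := hK.exists_bound_of_continuousOn (S.u_smooth n).continuous.continuousOn
    refine ⟨M, (norm_nonneg _).trans (hM 0 (by simp; linarith)), fun k => ?_⟩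
    obtain ⟨G, hG, h⟩ := exists_add_mem_fundamentalDomain (recipBasis S.prim) k
    refine (norm_u_le_add S n k hG).trans (hM _ ?_)
    rw [mem_closedBall_zero_iff]; linarith [hR _ h]
  have h2 : ∀ n, ∃ K : ℝ≥0,
      LipschitzOnWith K (S.u n) (Metric.closedBall (0 : E) (R + 1)) := fun n =>
    ((S.u_smooth n).of_le (by simp)).locallyLipschitz.locallyLipschitzOn
      |>.exists_lipschitzOnWith_of_compact hK
  choose M hM0 hM using h1
  choose Λ hΛ using h2
  have hΛ' : ∀ n k k', ‖S.u n k - S.u n k'‖ ≤ (Λ n + 2 * M n) * ‖k - k'‖ := by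
    intro n k k'
    rcases le_or_gt ‖k - k'‖ 1 with h | h
    · obtain ⟨G, hG, hk⟩ := exists_add_mem_fundamentalDomain (recipBasis S.prim) k
      have hk1 : k + G ∈ Metric.closedBall (0 : E) (R + 1) := by
        rw [mem_closedBall_zero_iff]; linarith [hR _ hk]
      have hk2 : k' + G ∈ Metric.closedBall (0 : E) (R + 1) := by
        rw [mem_closedBall_zero_iff]
        have : ‖k' + G‖ ≤ ‖k + G‖ + ‖k - k'‖ := by
          simpa [add_comm k' G] using norm_sub_le (k + G) (k - k')
        linarith [hR _ hk]
      have h3 := (hΛ n).norm_sub_le hk1 hk2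
      rw [add_sub_add_right_eq_sub] at h3
      refine (norm_u_sub_u_le_add S n k k' hG).trans (h3.trans ?_)
      gcongr
      linarith [hM0 n]
    · refine (norm_sub_le _ _).trans ?_
      have : (0 : ℝ) ≤ Λ n := (Λ n).2
      nlinarith [hM n k, hM n k', hM0 n]
  refine ⟨∑ n, (Λ n + 2 * M n) + 1, ?_, fun n k => ?_, fun n k k' => ?_⟩
  · have : 0 ≤ ∑ n, ((Λ n : ℝ) + 2 * M n) :=
      Finset.sum_nonneg fun n _ => by have := hM0 n; positivity
    linarith
  · have := Finset.single_le_sum (f := fun n => (Λ n : ℝ) + 2 * M n)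
      (fun n _ => by have := hM0 n; positivity) (Finset.mem_univ n)
    have h0 : (0 : ℝ) ≤ Λ n := (Λ n).2
    linarith [hM n k, hM0 n]
  · refine (hΛ' n k k').trans ?_
    refine mul_le_mul_of_nonneg_right ?_ (norm_nonneg _)
    have := Finset.single_le_sum (f := fun n => (Λ n : ℝ) + 2 * M n)
      (fun n _ => by have := hM0 n; positivity) (Finset.mem_univ n)
    linarith

end Orbitals

/-! ### The electron repulsion integrals -/

section Coulomb

variable {nocc nvir : ℕ} (S : PeriodicSystem nocc nvir)

theorem pairProduct_eq_fourierIntegral (n' : Band nocc nvir) (k' : E) (n : Band nocc nvir)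
    (k G : E) :
    S.pairProduct n' k' n k G = fourierIntegral S (star (S.u n' k') * S.u n k) G := by
  refine integral_congr_ae (Eventually.of_forall fun r => ?_)
  simp only [exp_neg_eq_planeWave, BoundedContinuousFunction.mul_apply,
    BoundedContinuousFunction.star_apply, starRingEnd_apply]
  ring

/-- The periodic gauge turns reciprocal lattice shifts of the momenta into shifts of `G`. -/
theorem pairProduct_add (n' : Band nocc nvir) (k' : E) (n : Band nocc nvir) (k G : E) {H' H : E}
    (hH' : H' ∈ S.recipLattice) (hH : H ∈ S.recipLattice) :
    S.pairProduct n' (k' + H') n (k + H) G = S.pairProduct n' k' n k (G + (H - H')) := by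
  refine integral_congr_ae (Eventually.of_forall fun r => ?_)
  have e : planeWave (-(G + (H - H'))) r = planeWave H' r * planeWave (-G) r * planeWave (-H) r := by
    have e' : -(G + (H - H')) = H' + -G + -H := by abel
    rw [e', planeWave_add_left, planeWave_add_left]
  simp only [exp_neg_eq_planeWave, u_add S _ _ hH', u_add S _ _ hH, map_mul, conj_planeWave, neg_neg,
    e]
  ring

/-- Half of a term of the Coulomb sum: the pair product divided by the length of the momentum
transfer. It is `0` at zero momentum transfer, in accordance with the omission of that term. -/
def coupling (n' : Band nocc nvir) (k' : E) (n : Band nocc nvir) (k : E) (G : E) : ℂ :=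
  S.pairProduct n' k' n k G / (‖k - k' + G‖ : ℝ)

theorem eri_eq_tsum_coupling (n₁ n₂ n₃ n₄ : Band nocc nvir) (k₁ k₂ k₃ : E) :
    S.eri n₁ n₂ n₃ n₄ k₁ k₂ k₃ = ((4 * Real.pi / (volume S.cell).toReal : ℝ) : ℂ) *
      ∑' G : S.recipLattice, coupling S n₁ k₁ n₃ k₃ G
        * coupling S n₂ k₂ n₄ (k₁ + k₂ - k₃) (-(G : E)) := by
  rw [PeriodicSystem.eri]
  congr 2
  ext G
  have e : ‖k₁ + k₂ - k₃ - k₂ + -(G : E)‖ = ‖k₃ - k₁ + (G : E)‖ := by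
    rw [← norm_neg]; congr 1; abel
  rw [coupling, coupling, e]
  split_ifs with h
  · simp [h]
  · push_cast
    ring

theorem coupling_add (n' : Band nocc nvir) (k' : E) (n : Band nocc nvir) (k G : E) {H' H : E}
    (hH' : H' ∈ S.recipLattice) (hH : H ∈ S.recipLattice) :
    coupling S n' (k' + H') n (k + H) G = coupling S n' k' n k (G + (H - H')) := by
  have e : k + H - (k' + H') + G = k - k' + (G + (H - H')) := by abel
  rw [coupling, coupling, pairProduct_add S n' k' n k G hH' hH, e]

theorem eri_add (n₁ n₂ n₃ n₄ : Band nocc nvir) (k₁ k₂ k₃ : E) {H₁ H₂ H₃ : E}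
    (h₁ : H₁ ∈ S.recipLattice) (h₂ : H₂ ∈ S.recipLattice) (h₃ : H₃ ∈ S.recipLattice) :
    S.eri n₁ n₂ n₃ n₄ (k₁ + H₁) (k₂ + H₂) (k₃ + H₃) = S.eri n₁ n₂ n₃ n₄ k₁ k₂ k₃ := by
  rw [eri_eq_tsum_coupling, eri_eq_tsum_coupling]
  congr 1
  rw [← (Equiv.addRight (⟨H₃ - H₁, sub_mem h₃ h₁⟩ : S.recipLattice)).tsum_eq
    (fun G : S.recipLattice => coupling S n₁ k₁ n₃ k₃ G
        * coupling S n₂ k₂ n₄ (k₁ + k₂ - k₃) (-(G : E)))]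
  refine tsum_congr fun G => ?_
  have e : k₁ + H₁ + (k₂ + H₂) - (k₃ + H₃) = k₁ + k₂ - k₃ + (H₁ + H₂ - H₃) := by abel
  rw [e, coupling_add S _ _ _ _ _ h₁ h₃,
    coupling_add S _ _ _ _ _ h₂ (sub_mem (add_mem h₁ h₂) h₃)]
  congr 2
  simp only [Equiv.coe_addRight, Submodule.coe_add]
  abel

/-- By orthonormality of the orbitals, the pair product of two distinct bands is at most of the order
of the momentum transfer. -/
theorem norm_pairProduct_le {M : ℝ} (hM : ∀ n k, ‖S.u n k‖ ≤ M)
    (hL : ∀ n k k', ‖S.u n k - S.u n k'‖ ≤ M * ‖k - k'‖) {n' n : Band nocc nvir} (hn : n' ≠ n)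
    (k' k : E) {G : E} (hG : G ∈ S.recipLattice) :
    ‖S.pairProduct n' k' n k G‖ ≤ M * M * cellVolume S * ‖k - k' + G‖ := by
  have hM0 : 0 ≤ M := (norm_nonneg _).trans (hM n' k')
  have h1 : S.pairProduct n' k' n k G = S.pairProduct n' k' n (k + G) 0 := by
    have := pairProduct_add S n' k' n k 0 (zero_mem _) hG
    rw [add_zero] at this
    rw [this]; simp
  have h2 : S.pairProduct n' k' n k' 0 = 0 := by
    have := S.orthonormal n' n k'
    rw [if_neg hn] at this
    rw [← this]
    refine integral_congr_ae (Eventually.of_forall fun r => ?_)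
    simp
  have h3 : S.pairProduct n' k' n k G
      = fourierIntegral S (star (S.u n' k') * (S.u n (k + G) - S.u n k')) 0 := by
    rw [mul_sub, fourierIntegral_sub, ← pairProduct_eq_fourierIntegral,
      ← pairProduct_eq_fourierIntegral, h2, sub_zero, h1]
  rw [h3]
  refine (norm_fourierIntegral_le S _ _).trans ?_
  have hvol := (cellVolume_pos S).le
  calc _ ≤ (‖star (S.u n' k')‖ * ‖S.u n (k + G) - S.u n k'‖) * cellVolume S := by
        gcongr; exact norm_mul_le _ _
    _ ≤ (M * (M * ‖k + G - k'‖)) * cellVolume S := by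
        rw [norm_star]
        gcongr
        · exact hM n' k'
        · exact hL _ _ _
    _ = _ := by rw [add_sub_right_comm]; ring

/-- The number of reciprocal lattice vectors in a unit ball is bounded, independently of its centre. -/
theorem exists_card_near_le (b : Module.Basis (Fin 3) ℝ E) :
    ∃ N : ℕ, ∀ (q : E) (s : Finset (lattice b)), (∀ G ∈ s, ‖q + (G : E)‖ ≤ 1) → s.card ≤ N := by
  obtain ⟨R, hR0, hR⟩ := exists_norm_le_of_mem_fundamentalDomain b
  set T := (finite_lattice_norm_le b (R + 1)).toFinset with hT
  refine ⟨T.card, fun q s hs => ?_⟩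
  obtain ⟨H, hH, h⟩ := exists_add_mem_fundamentalDomain b q
  refine Finset.card_le_card_of_injOn (fun G => (G : E) - H) (fun G hG => ?_) ?_
  · rw [hT, Set.Finite.coe_toFinset]
    refine ⟨sub_mem G.2 hH, ?_⟩
    have e : (G : E) - H = (q + G) - (q + H) := by abel
    simp only [e]
    have := norm_sub_le (q + (G : E)) (q + H)
    linarith [hs G hG, hR _ h]
  · intro G _ G' _ h
    exact Subtype.ext (sub_left_injective h)

/-- The couplings of two distinct bands are square summable, uniformly in the momenta: for small
momentum transfer by orthonormality, otherwise by Bessel's inequality. -/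
theorem exists_hasL2Bound_coupling : ∃ A : ℝ, ∀ (n' n : Band nocc nvir), n' ≠ n → ∀ k' k,
    HasL2Bound (fun G : S.recipLattice => coupling S n' k' n k G) A := by
  obtain ⟨M, hM0, hM, hL⟩ := exists_norm_u_le S
  obtain ⟨N, hN⟩ := exists_card_near_le (recipBasis S.prim)
  have hvol := cellVolume_pos S
  set c := M * M * cellVolume S with hc
  have hc0 : 0 ≤ c := by positivity
  refine ⟨√(c ^ 2 + N * c ^ 2), fun n' n hn k' k => ⟨Real.sqrt_nonneg _, fun s => ?_⟩⟩
  rw [Real.sq_sqrt (by positivity)]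
  classical
  set q := k - k' with hq
  rw [← Finset.sum_filter_add_sum_filter_not s (fun G : S.recipLattice => 1 < ‖q + (G : E)‖)]
  have hfar : ∑ G ∈ s.filter (fun G : S.recipLattice => 1 < ‖q + (G : E)‖), ‖coupling S n' k' n k G‖ ^ 2 ≤ c ^ 2 := by
    have hB := (hasL2Bound_fourierIntegral S (star (S.u n' k') * S.u n k)).2
      (s.filter fun G : S.recipLattice => 1 < ‖q + (G : E)‖)
    have hle : ∑ G ∈ s.filter (fun G : S.recipLattice => 1 < ‖q + (G : E)‖), ‖coupling S n' k' n k G‖ ^ 2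
        ≤ ∑ G ∈ s.filter (fun G : S.recipLattice => 1 < ‖q + (G : E)‖),
          ‖fourierIntegral S (star (S.u n' k') * S.u n k) G‖ ^ 2 := by
      refine Finset.sum_le_sum fun G hG => ?_
      have h1 := (Finset.mem_filter.mp hG).2
      rw [coupling, ← pairProduct_eq_fourierIntegral, norm_div, Complex.norm_real, norm_norm]
      exact pow_le_pow_left₀ (by positivity) (div_le_self (norm_nonneg _) h1.le) 2
    refine hle.trans (hB.trans ?_)
    refine pow_le_pow_left₀ (by positivity) ?_ 2
    rw [hc]
    gcongr
    refine (norm_mul_le _ _).trans ?_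
    rw [norm_star]
    exact mul_le_mul (hM _ _) (hM _ _) (norm_nonneg _) hM0.le
  have hnear : ∑ G ∈ s.filter (fun G : S.recipLattice => ¬ 1 < ‖q + (G : E)‖), ‖coupling S n' k' n k G‖ ^ 2 ≤ N * c ^ 2 := by
    have hle : ∀ G ∈ s.filter (fun G : S.recipLattice => ¬ 1 < ‖q + (G : E)‖),
        ‖coupling S n' k' n k G‖ ^ 2 ≤ c ^ 2 := by
      intro G _
      refine pow_le_pow_left₀ (norm_nonneg _) ?_ 2
      rw [coupling, norm_div, Complex.norm_real, norm_norm]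
      exact div_le_of_le_mul₀ (norm_nonneg _) hc0 (norm_pairProduct_le S hM hL hn k' k G.2)
    refine (Finset.sum_le_card_nsmul _ _ _ hle).trans ?_
    rw [nsmul_eq_mul]
    gcongr
    exact hN q _ fun G hG => not_lt.mp (Finset.mem_filter.mp hG).2
  exact add_le_add hfar hnear

/-- The couplings are Lipschitz continuous in `ℓ²` away from the lattice of singular momentum
transfers, with a constant inversely proportional to the distance. -/
theorem exists_hasL2Bound_coupling_sub : ∃ A : ℝ, ∀ (n' n : Band nocc nvir), n' ≠ n →
    ∀ k' k l' l, HasL2Bound (fun G : S.recipLattice =>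
      (latticeDist (recipBasis S.prim) (k - k') : ℂ)
        * (coupling S n' k' n k G - coupling S n' l' n l G)) (A * (‖k - l‖ + ‖k' - l'‖)) := by
  obtain ⟨M, hM0, hM, hL⟩ := exists_norm_u_le S
  obtain ⟨A, hA⟩ := exists_hasL2Bound_coupling S
  have hvol := cellVolume_pos S
  set c := M * M * cellVolume S with hc
  have hc0 : 0 ≤ c := by positivity
  refine ⟨√(4 * A ^ 2 + 2 * c ^ 2), fun n' n hn k' k l' l => ⟨by positivity, fun s => ?_⟩⟩
  set h := ‖k - l‖ + ‖k' - l'‖ with hh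
  set d := latticeDist (recipBasis S.prim) (k - k') with hd
  have hh0 : 0 ≤ h := by positivity
  have hd0 : 0 ≤ d := latticeDist_nonneg _ _
  rw [mul_pow, Real.sq_sqrt (by positivity)]
  have hAk := (hA n' n hn k' k).2 s
  have hAl := (hA n' n hn l' l).2 s
  have hnorm : ∀ z : ℂ, ‖(d : ℂ) * z‖ ^ 2 = d ^ 2 * ‖z‖ ^ 2 := fun z => by
    rw [norm_mul, Complex.norm_real, Real.norm_of_nonneg hd0, mul_pow]
  have hsq : ∀ x y : ℝ, (x + y) ^ 2 ≤ 2 * x ^ 2 + 2 * y ^ 2 := fun x y => by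
    nlinarith [sq_nonneg (x - y)]
  simp only [hnorm]
  rw [← Finset.mul_sum]
  rcases le_or_gt d h with hdh | hdh
  · have h1 : ∑ G ∈ s, ‖coupling S n' k' n k G - coupling S n' l' n l G‖ ^ 2 ≤ 4 * A ^ 2 := by
      calc _ ≤ ∑ G ∈ s, (2 * ‖coupling S n' k' n k G‖ ^ 2 + 2 * ‖coupling S n' l' n l G‖ ^ 2) :=
            Finset.sum_le_sum fun G _ =>
              (pow_le_pow_left₀ (norm_nonneg _) (norm_sub_le _ _) 2).trans (hsq _ _)
        _ ≤ 4 * A ^ 2 := by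
            rw [Finset.sum_add_distrib, ← Finset.mul_sum, ← Finset.mul_sum]
            linarith
    calc _ ≤ h ^ 2 * (4 * A ^ 2) := by gcongr
      _ ≤ _ := by nlinarith [sq_nonneg (h * c)]
  · -- No momentum transfer vanishes, and
    -- `V - V' = (ϱ - ϱ') / |q + G| + V' (|q' + G| - |q + G|) / |q + G|`.
    set g := star (S.u n' k') * S.u n k with hg
    set g' := star (S.u n' l') * S.u n l with hg'
    have hgg : ‖g - g'‖ ≤ M * M * h := by
      have e : g - g' = star (S.u n' k' - S.u n' l') * S.u n k
          + star (S.u n' l') * (S.u n k - S.u n l) := by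
        rw [hg, hg', star_sub]; ring
      rw [e]
      calc _ ≤ ‖star (S.u n' k' - S.u n' l')‖ * ‖S.u n k‖
            + ‖star (S.u n' l')‖ * ‖S.u n k - S.u n l‖ :=
            (norm_add_le _ _).trans (add_le_add (norm_mul_le _ _) (norm_mul_le _ _))
        _ ≤ (M * ‖k' - l'‖) * M + M * (M * ‖k - l‖) := by
            rw [norm_star, norm_star]
            gcongr
            · exact hL _ _ _
            · exact hM _ _
            · exact hM _ _
            · exact hL _ _ _
        _ = _ := by rw [hh]; ring
    have hpt : ∀ G : S.recipLattice, d ^ 2 * ‖coupling S n' k' n k G - coupling S n' l' n l G‖ ^ 2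
        ≤ 2 * ‖fourierIntegral S (g - g') G‖ ^ 2 + 2 * (‖coupling S n' l' n l G‖ ^ 2 * h ^ 2) := by
      intro G
      have hq : d ≤ ‖k - k' + (G : E)‖ := latticeDist_le_norm_add _ _ G.2
      have hqq : ‖(k - k' + (G : E)) - (l - l' + (G : E))‖ ≤ h := by
        have e : (k - k' + (G : E)) - (l - l' + (G : E)) = (k - l) - (k' - l') := by abel
        rw [e]; exact norm_sub_le _ _
      set x := ‖k - k' + (G : E)‖ with hx
      set y := ‖l - l' + (G : E)‖ with hy
      have hxy : |x - y| ≤ h := (abs_norm_sub_norm_le _ _).trans hqq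
      have hx0 : 0 < x := by linarith
      have hy0 : 0 < y := by linarith [(abs_le.mp hxy).2]
      have e : coupling S n' k' n k G - coupling S n' l' n l G
          = (fourierIntegral S (g - g') G + coupling S n' l' n l G * ((y - x : ℝ) : ℂ)) / (x : ℂ) := by
        rw [coupling, coupling, fourierIntegral_sub, ← pairProduct_eq_fourierIntegral,
          ← pairProduct_eq_fourierIntegral, ← hx, ← hy]
        have hx' : (x : ℂ) ≠ 0 := by exact_mod_cast hx0.ne'
        have hy' : (y : ℂ) ≠ 0 := by exact_mod_cast hy0.ne'
        push_cast
        field_simp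
        ring
      have h1 : d * ‖coupling S n' k' n k G - coupling S n' l' n l G‖
          ≤ ‖fourierIntegral S (g - g') G‖ + ‖coupling S n' l' n l G‖ * h := by
        rw [e, norm_div, Complex.norm_real, Real.norm_of_nonneg hx0.le, mul_div_assoc',
          div_le_iff₀ hx0, mul_comm]
        refine mul_le_mul ?_ hq hd0 (by positivity)
        refine (norm_add_le _ _).trans ?_
        rw [norm_mul, Complex.norm_real, Real.norm_eq_abs, abs_sub_comm]
        gcongr
      rw [← mul_pow, ← mul_pow]
      exact (pow_le_pow_left₀ (by positivity) h1 2).trans (hsq _ _)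
    rw [Finset.mul_sum]
    have hB := (hasL2Bound_fourierIntegral S (g - g')).2 s
    have hB' : (‖g - g'‖ * cellVolume S) ^ 2 ≤ c ^ 2 * h ^ 2 := by
      rw [← mul_pow]
      refine pow_le_pow_left₀ (by positivity) ?_ 2
      calc _ ≤ M * M * h * cellVolume S := by gcongr
        _ = _ := by rw [hc]; ring
    calc _ ≤ ∑ G ∈ s, (2 * ‖fourierIntegral S (g - g') G‖ ^ 2
            + 2 * (‖coupling S n' l' n l G‖ ^ 2 * h ^ 2)) := Finset.sum_le_sum fun G _ => hpt G
      _ = 2 * ∑ G ∈ s, ‖fourierIntegral S (g - g') G‖ ^ 2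
            + 2 * ((∑ G ∈ s, ‖coupling S n' l' n l G‖ ^ 2) * h ^ 2) := by
          rw [Finset.sum_add_distrib, ← Finset.mul_sum, ← Finset.mul_sum, Finset.sum_mul]
      _ ≤ 2 * (c ^ 2 * h ^ 2) + 2 * (A ^ 2 * h ^ 2) := by
          gcongr
          exact hB.trans hB'
      _ ≤ _ := by nlinarith [sq_nonneg (A * h)]

/-- Electron repulsion integrals whose pair products involve distinct bands are bounded: the
singularity of the Coulomb kernel cancels. -/
theorem exists_norm_eri_le : ∃ C : ℝ, ∀ (n₁ n₂ n₃ n₄ : Band nocc nvir), n₁ ≠ n₃ → n₂ ≠ n₄ →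
    ∀ k₁ k₂ k₃, ‖S.eri n₁ n₂ n₃ n₄ k₁ k₂ k₃‖ ≤ C := by
  obtain ⟨A, hA⟩ := exists_hasL2Bound_coupling S
  refine ⟨‖((4 * Real.pi / (volume S.cell).toReal : ℝ) : ℂ)‖ * (A * A),
    fun n₁ n₂ n₃ n₄ h13 h24 k₁ k₂ k₃ => ?_⟩
  rw [eri_eq_tsum_coupling, norm_mul]
  gcongr
  exact (hA _ _ h13 k₁ k₃).norm_tsum_mul_le
    ((hA _ _ h24 k₂ (k₁ + k₂ - k₃)).comp_equiv (Equiv.neg S.recipLattice))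

/-- Cauchy-Schwarz in `ℓ²` turns the Lipschitz estimate for the couplings into one for the integrals. -/
theorem exists_latticeDist_mul_norm_eri_sub_le : ∃ C : ℝ, 0 ≤ C ∧
    ∀ (n₁ n₂ n₃ n₄ : Band nocc nvir), n₁ ≠ n₃ → n₂ ≠ n₄ → ∀ k₁ k₂ k₃ l₁ l₂ l₃,
      latticeDist (recipBasis S.prim) (k₃ - k₁)
        * ‖S.eri n₁ n₂ n₃ n₄ k₁ k₂ k₃ - S.eri n₁ n₂ n₃ n₄ l₁ l₂ l₃‖
      ≤ C * (‖k₁ - l₁‖ + ‖k₂ - l₂‖ + ‖k₃ - l₃‖) := by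
  obtain ⟨A, hA⟩ := exists_hasL2Bound_coupling S
  obtain ⟨B, hB⟩ := exists_hasL2Bound_coupling_sub S
  set c : ℂ := ((4 * Real.pi / (volume S.cell).toReal : ℝ) : ℂ) with hc
  refine ⟨‖c‖ * (3 * |A| * |B|), by positivity,
    fun n₁ n₂ n₃ n₄ h13 h24 k₁ k₂ k₃ l₁ l₂ l₃ => ?_⟩
  set d := latticeDist (recipBasis S.prim) (k₃ - k₁) with hd
  have hd0 : 0 ≤ d := latticeDist_nonneg _ _
  have hd' : latticeDist (recipBasis S.prim) (k₁ + k₂ - k₃ - k₂) = d := by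
    rw [hd, ← latticeDist_neg]; congr 1; abel
  have a1 := hA _ _ h13 k₁ k₃
  have a1' := hA _ _ h13 l₁ l₃
  have a2 := (hA _ _ h24 k₂ (k₁ + k₂ - k₃)).comp_equiv (Equiv.neg S.recipLattice)
  have a2' := (hA _ _ h24 l₂ (l₁ + l₂ - l₃)).comp_equiv (Equiv.neg S.recipLattice)
  have b1 := hB _ _ h13 k₁ k₃ l₁ l₃
  have b2 := (hB _ _ h24 k₂ (k₁ + k₂ - k₃) l₂ (l₁ + l₂ - l₃)).comp_equiv
    (Equiv.neg S.recipLattice)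
  rw [hd'] at b2
  rw [← hd] at b1
  have hneg : ∀ G : S.recipLattice, ((Equiv.neg S.recipLattice G : S.recipLattice) : E) = -(G : E) :=
    fun _ => rfl
  simp only [hneg] at a2 a2' b2
  have hsplit : (d : ℂ) * (S.eri n₁ n₂ n₃ n₄ k₁ k₂ k₃ - S.eri n₁ n₂ n₃ n₄ l₁ l₂ l₃)
      = c * (∑' G : S.recipLattice, (d * (coupling S n₁ k₁ n₃ k₃ G - coupling S n₁ l₁ n₃ l₃ G))
            * coupling S n₂ k₂ n₄ (k₁ + k₂ - k₃) (-(G : E))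
          + ∑' G : S.recipLattice, coupling S n₁ l₁ n₃ l₃ G
            * (d * (coupling S n₂ k₂ n₄ (k₁ + k₂ - k₃) (-(G : E))
              - coupling S n₂ l₂ n₄ (l₁ + l₂ - l₃) (-(G : E))))) := by
    rw [← (b1.summable_mul a2).tsum_add (a1'.summable_mul b2), eri_eq_tsum_coupling,
      eri_eq_tsum_coupling, ← hc, ← mul_sub,
      ← (a1.summable_mul a2).tsum_sub (a1'.summable_mul a2'), mul_left_comm, ← tsum_mul_left]
    congr 1
    refine tsum_congr fun G => ?_
    ring
  have hnorm : ‖(d : ℂ) * (S.eri n₁ n₂ n₃ n₄ k₁ k₂ k₃ - S.eri n₁ n₂ n₃ n₄ l₁ l₂ l₃)‖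
      = d * ‖S.eri n₁ n₂ n₃ n₄ k₁ k₂ k₃ - S.eri n₁ n₂ n₃ n₄ l₁ l₂ l₃‖ := by
    rw [norm_mul, Complex.norm_real, Real.norm_of_nonneg hd0]
  rw [← hnorm, hsplit, norm_mul, mul_assoc]
  refine mul_le_mul_of_nonneg_left ?_ (norm_nonneg c)
  refine (norm_add_le _ _).trans
    ((add_le_add (b1.norm_tsum_mul_le a2) (a1'.norm_tsum_mul_le b2)).trans ?_)
  have hk4 : ‖k₁ + k₂ - k₃ - (l₁ + l₂ - l₃)‖ ≤ ‖k₁ - l₁‖ + ‖k₂ - l₂‖ + ‖k₃ - l₃‖ := by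
    have e : k₁ + k₂ - k₃ - (l₁ + l₂ - l₃) = (k₁ - l₁) + (k₂ - l₂) - (k₃ - l₃) := by abel
    rw [e]
    exact (norm_sub_le _ _).trans (add_le_add_left (norm_add_le _ _) _)
  set x := ‖k₁ - l₁‖
  set y := ‖k₂ - l₂‖
  set z := ‖k₃ - l₃‖
  have hx : 0 ≤ x := norm_nonneg _
  have hy : 0 ≤ y := norm_nonneg _
  have hz : 0 ≤ z := norm_nonneg _
  have hAB : A * B ≤ |A| * |B| := by rw [← abs_mul]; exact le_abs_self _
  have hAB0 : 0 ≤ |A| * |B| := by positivity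
  set w := ‖k₁ + k₂ - k₃ - (l₁ + l₂ - l₃)‖
  have hw : 0 ≤ w := norm_nonneg _
  calc B * (z + x) * A + A * (B * (w + y)) = (A * B) * (z + x + w + y) := by ring
    _ ≤ (|A| * |B|) * (z + x + w + y) := by gcongr
    _ ≤ (|A| * |B|) * (3 * (x + y + z)) := by gcongr; linarith
    _ = _ := by ring

/-- The antisymmetrized integrals `W_{ijab}` are mildly singular. -/
theorem isMildlySingular_antisymERI (i j : Fin nocc) (a b : Fin nvir) :
    IsMildlySingular (recipBasis S.prim) fun p => S.antisymERI i j a b p.1 p.2.1 p.2.2 := by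
  obtain ⟨M, hM⟩ := exists_norm_eri_le S
  obtain ⟨C, hC0, hC⟩ := exists_latticeDist_mul_norm_eri_sub_le S
  have hdirect : IsMildlySingular (recipBasis S.prim) fun p =>
      S.eri (.inl i) (.inl j) (.inr a) (.inr b) p.1 p.2.1 p.2.2 := by
    refine ⟨fun p g h1 h2 h3 => eri_add S _ _ _ _ _ _ _ h1 h2 h3,
      ⟨M, fun p => hM _ _ _ _ (by simp) (by simp) _ _ _⟩, ⟨C * 3, fun p p' => ?_⟩⟩
    refine (mul_le_mul_of_nonneg_right (min_le_left _ _) (norm_nonneg _)).trans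
      ((hC _ _ _ _ (by simp) (by simp) _ _ _ _ _ _).trans ?_)
    have h1 : ‖p.1 - p'.1‖ ≤ ‖p - p'‖ := norm_fst_le (p - p')
    have h2 : ‖p.2.1 - p'.2.1‖ ≤ ‖p - p'‖ := (norm_fst_le (p - p').2).trans (norm_snd_le (p - p'))
    have h3 : ‖p.2.2 - p'.2.2‖ ≤ ‖p - p'‖ := (norm_snd_le (p - p').2).trans (norm_snd_le (p - p'))
    rw [mul_assoc]
    exact mul_le_mul_of_nonneg_left (by linarith) hC0
  have hexchange : IsMildlySingular (recipBasis S.prim) fun p =>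
      S.eri (.inl i) (.inl j) (.inr b) (.inr a) p.1 p.2.1 (p.1 + p.2.1 - p.2.2) := by
    refine ⟨fun p g h1 h2 h3 => ?_,
      ⟨M, fun p => hM _ _ _ _ (by simp) (by simp) _ _ _⟩, ⟨C * 5, fun p p' => ?_⟩⟩
    · have e : (p + g).1 + (p + g).2.1 - (p + g).2.2
          = p.1 + p.2.1 - p.2.2 + (g.1 + g.2.1 - g.2.2) := by
        simp only [Prod.fst_add, Prod.snd_add]; abel
      rw [e]
      exact eri_add S _ _ _ _ _ _ _ h1 h2 (sub_mem (add_mem h1 h2) h3)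
    · have e : latticeDist (recipBasis S.prim) (p.1 + p.2.1 - p.2.2 - p.1)
          = latticeDist (recipBasis S.prim) (p.2.1 - p.2.2) := by congr 1; abel
      have hmin : transferDist (recipBasis S.prim) p
          ≤ latticeDist (recipBasis S.prim) (p.1 + p.2.1 - p.2.2 - p.1) := by
        rw [e]; exact min_le_right _ _
      refine (mul_le_mul_of_nonneg_right hmin (norm_nonneg _)).trans
        ((hC _ _ _ _ (by simp) (by simp) _ _ _ _ _ _).trans ?_)
      have h1 : ‖p.1 - p'.1‖ ≤ ‖p - p'‖ := norm_fst_le (p - p')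
      have h2 : ‖p.2.1 - p'.2.1‖ ≤ ‖p - p'‖ :=
        (norm_fst_le (p - p').2).trans (norm_snd_le (p - p'))
      have h3 : ‖p.2.2 - p'.2.2‖ ≤ ‖p - p'‖ :=
        (norm_snd_le (p - p').2).trans (norm_snd_le (p - p'))
      have h4 : ‖p.1 + p.2.1 - p.2.2 - (p'.1 + p'.2.1 - p'.2.2)‖
          ≤ ‖p.1 - p'.1‖ + ‖p.2.1 - p'.2.1‖ + ‖p.2.2 - p'.2.2‖ := by
        have e : p.1 + p.2.1 - p.2.2 - (p'.1 + p'.2.1 - p'.2.2)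
            = (p.1 - p'.1) + (p.2.1 - p'.2.1) - (p.2.2 - p'.2.2) := by abel
        rw [e]
        exact (norm_sub_le _ _).trans (add_le_add_left (norm_add_le _ _) _)
      rw [mul_assoc]
      exact mul_le_mul_of_nonneg_left (by linarith) hC0
  exact ((IsMildlySingular.const 2).mul hdirect).sub hexchange

end Coulomb

/-! ### Exact amplitudes are mildly singular -/

section AmplitudeSpace

variable {nocc nvir : ℕ} {S : PeriodicSystem nocc nvir} {f : E → E → E → ℂ}

theorem PeriodicSystem.InT.add_triple (hf : S.InT f) (p g : E × E × E) (h1 : g.1 ∈ S.recipLattice)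
    (h2 : g.2.1 ∈ S.recipLattice) (h3 : g.2.2 ∈ S.recipLattice) :
    f (p + g).1 (p + g).2.1 (p + g).2.2 = f p.1 p.2.1 p.2.2 := by
  simp only [Prod.fst_add, Prod.snd_add]
  rw [(hf.periodic g.1 h1 p.1 (p.2.1 + g.2.1) (p.2.2 + g.2.2)).1,
    (hf.periodic g.2.1 h2 p.1 p.2.1 (p.2.2 + g.2.2)).2.1,
    (hf.periodic g.2.2 h3 p.1 p.2.1 p.2.2).2.2]

/-- A function that is continuous off the singular set and periodic in each variable is bounded at
any positive distance from the singular set. -/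
theorem exists_norm_le_of_latticeDist_ge {W : Type*} [NormedAddCommGroup W]
    (b : Module.Basis (Fin 3) ℝ E) {Φ : E × E × E → W}
    (hper : ∀ p g : E × E × E, g.1 ∈ lattice b → g.2.1 ∈ lattice b → g.2.2 ∈ lattice b →
      Φ (p + g) = Φ p)
    (hcont : ContinuousOn Φ {p | p.2.2 - p.1 ∉ lattice b}) {η : ℝ} (hη : 0 < η) :
    ∃ C : ℝ, ∀ p : E × E × E, η ≤ latticeDist b (p.2.2 - p.1) → ‖Φ p‖ ≤ C := by
  obtain ⟨R, hR0, hR⟩ := exists_norm_le_of_mem_fundamentalDomain b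
  have hclosed : IsClosed {p : E × E × E | η ≤ latticeDist b (p.2.2 - p.1)} :=
    isClosed_le continuous_const ((continuous_latticeDist b).comp (by fun_prop))
  have hK : IsCompact (Metric.closedBall (0 : E × E × E) R
      ∩ {p : E × E × E | η ≤ latticeDist b (p.2.2 - p.1)}) :=
    (isCompact_closedBall _ _).inter_right hclosed
  obtain ⟨C, hC⟩ := hK.exists_bound_of_continuousOn (hcont.mono fun p hp =>
    (latticeDist_pos_iff b).mp (hη.trans_le hp.2))
  refine ⟨C, fun p hp => ?_⟩
  obtain ⟨G₁, h₁, e₁⟩ := exists_add_mem_fundamentalDomain b p.1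
  obtain ⟨G₂, h₂, e₂⟩ := exists_add_mem_fundamentalDomain b p.2.1
  obtain ⟨G₃, h₃, e₃⟩ := exists_add_mem_fundamentalDomain b p.2.2
  rw [← hper p (G₁, G₂, G₃) h₁ h₂ h₃]
  refine hC _ ⟨?_, ?_⟩
  · rw [mem_closedBall_zero_iff]
    exact norm_prod_le_iff.mpr ⟨hR _ e₁, norm_prod_le_iff.mpr ⟨hR _ e₂, hR _ e₃⟩⟩
  · simp only [Set.mem_ofPred_eq, Prod.fst_add, Prod.snd_add, add_sub_add_comm]
    rwa [latticeDist_add b (sub_mem h₃ h₁)]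

/-- The bounds on zeroth and first derivatives contained in an algebraic singularity of order `0`
at the origin. -/
theorem HasAlgebraicSingularity.exists_bounds {X Y : Type*} [NormedAddCommGroup X]
    [NormedSpace ℝ X] [NormedAddCommGroup Y] [NormedSpace ℝ Y] {g : X → Y → ℂ}
    (h : HasAlgebraicSingularity g 0 0) :
    ∃ δ > 0, ∃ C : ℝ, 0 ≤ C ∧ ∀ x, 0 < ‖x‖ → ‖x‖ < δ → ∀ y,
      ‖g x y‖ ≤ C ∧ ‖fderiv ℝ (g x) y‖ ≤ C ∧ ‖fderiv ℝ (fun x' => g x' y) x‖ ≤ C * ‖x‖⁻¹ := by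
  obtain ⟨-, δ, hδ, H⟩ := h
  obtain ⟨C₀, h₀⟩ := H 0 0
  obtain ⟨C₁, h₁⟩ := H 0 1
  obtain ⟨C₂, h₂⟩ := H 1 0
  simp only [sub_zero] at h₀ h₁ h₂
  refine ⟨δ, hδ, max 0 (max C₀ (max C₁ C₂)), le_max_left _ _, fun x hx hxδ y => ⟨?_, ?_, ?_⟩⟩
  · have := h₀ x hx hxδ y
    rw [norm_iteratedFDeriv_zero, norm_iteratedFDeriv_zero] at this
    refine this.trans ?_
    simp
  · have := h₁ x hx hxδ y
    rw [norm_iteratedFDeriv_zero, norm_iteratedFDeriv_one] at this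
    refine this.trans ?_
    simp
  · have := h₂ x hx hxδ y
    have e : (fun x' => iteratedFDeriv ℝ 0 (g x') y)
        = (continuousMultilinearCurryFin0 ℝ Y ℂ).symm ∘ (fun x' => g x' y) := rfl
    rw [e, LinearIsometryEquiv.norm_iteratedFDeriv_comp_left, norm_iteratedFDeriv_one] at this
    refine this.trans ?_
    have e2 : ‖x‖ ^ ((0 : ℝ) - ((1 : ℕ) : ℝ)) = ‖x‖⁻¹ := by
      rw [Nat.cast_one, zero_sub, Real.rpow_neg_one]
    rw [e2]
    gcongr
    simp

theorem isOpen_compl_singular (b : Module.Basis (Fin 3) ℝ E) :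
    IsOpen {p : E × E × E | p.2.2 - p.1 ∉ lattice b} :=
  (isClosed_lattice b).isOpen_compl.preimage
    (by fun_prop : Continuous fun p : E × E × E => p.2.2 - p.1)

/-- On the singular set, where the derivative bounds say nothing, the function is smooth in
`(k_i, k_j)`. -/
theorem PeriodicSystem.InT.exists_norm_le (hf : S.InT f) :
    ∃ M : ℝ, ∀ p : E × E × E, ‖f p.1 p.2.1 p.2.2‖ ≤ M := by
  set b := recipBasis S.prim with hb
  obtain ⟨δ, hδ, C, hC0, hC⟩ := hf.singularity.exists_bounds
  obtain ⟨C', hC'⟩ := exists_norm_le_of_latticeDist_ge b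
    (Φ := fun p : E × E × E => f p.1 p.2.1 p.2.2) hf.add_triple hf.smooth.continuousOn hδ
  obtain ⟨R, hR0, hR⟩ := exists_norm_le_of_mem_fundamentalDomain b
  obtain ⟨C'', hC''⟩ := (isCompact_closedBall (0 : E × E) R).exists_bound_of_continuousOn
    hf.smooth_diag.continuous.continuousOn
  refine ⟨max C (max C' C''), fun p => ?_⟩
  obtain ⟨H, hH, e⟩ := exists_norm_add_eq_latticeDist b (p.2.2 - p.1)
  have hp : f p.1 p.2.1 p.2.2 = f p.1 p.2.1 (p.1 + (p.2.2 - p.1 + H)) := by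
    have e' : p.1 + (p.2.2 - p.1 + H) = p.2.2 + H := by abel
    rw [e', (hf.periodic H hH _ _ _).2.2]
  rcases (norm_nonneg (p.2.2 - p.1 + H)).eq_or_lt with h0 | h0
  · refine le_trans ?_ ((le_max_right _ _).trans (le_max_right _ _))
    rw [hp, norm_eq_zero.mp h0.symm, add_zero]
    obtain ⟨G₁, h₁, e₁⟩ := exists_add_mem_fundamentalDomain b p.1
    obtain ⟨G₂, h₂, e₂⟩ := exists_add_mem_fundamentalDomain b p.2.1
    rw [← hf.add_triple (p.1, p.2.1, p.1) (G₁, G₂, G₁) h₁ h₂ h₁]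
    exact hC'' (p.1 + G₁, p.2.1 + G₂) (mem_closedBall_zero_iff.mpr
      (norm_prod_le_iff.mpr ⟨hR _ e₁, hR _ e₂⟩))
  · rcases lt_or_ge ‖p.2.2 - p.1 + H‖ δ with h | h
    · rw [hp]
      exact (hC _ h0 h (p.1, p.2.1)).1.trans (le_max_left _ _)
    · exact (hC' p (e ▸ h)).trans ((le_max_left _ _).trans (le_max_right _ _))

/-- The mean value inequality is applied to the total derivative away from the singularity, and near
it to the derivatives in the momentum transfer and in `(k_i, k_j)` separately. -/
theorem PeriodicSystem.InT.isMildlySingular (hf : S.InT f) :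
    IsMildlySingular (recipBasis S.prim) fun p => f p.1 p.2.1 p.2.2 := by
  obtain ⟨M, hM⟩ := hf.exists_norm_le
  refine ⟨hf.add_triple, ⟨M, hM⟩, ?_⟩
  set b := recipBasis S.prim with hb
  set F : E × E × E → ℂ := fun p => f p.1 p.2.1 p.2.2 with hF
  set U : Set (E × E × E) := {p | p.2.2 - p.1 ∉ S.recipLattice} with hU
  have hUo : IsOpen U := isOpen_compl_singular b
  have hdiff : ∀ p ∈ U, DifferentiableAt ℝ F p := fun p hp =>
    (hf.smooth.contDiffAt (hUo.mem_nhds hp)).differentiableAt (by simp)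
  have hM0 : 0 ≤ M := (norm_nonneg _).trans (hM 0)
  obtain ⟨δ, hδ, C, hC0, hC⟩ := hf.singularity.exists_bounds
  obtain ⟨C', hC'⟩ := exists_norm_le_of_latticeDist_ge b (Φ := fderiv ℝ F)
    (fun p g h1 h2 h3 => by
      rw [← fderiv_comp_add_right]
      congr 1
      ext p
      exact hf.add_triple p g h1 h2 h3)
    (hf.smooth.continuousOn_fderiv_of_isOpen hUo (by simp)) (η := δ / 4) (by positivity)
  obtain ⟨R, hR0, hR⟩ := exists_latticeDist_le b
  refine ⟨16 * M + (R * C + 4 * C) + R * |C'|, fun p p' => ?_⟩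
  set q := p.2.2 - p.1 with hq
  set D := latticeDist b q with hD
  have hD0 : 0 ≤ D := latticeDist_nonneg b q
  have hDR : D ≤ R := hR q
  have h1 : ‖p.1 - p'.1‖ ≤ ‖p - p'‖ := norm_fst_le (p - p')
  have h2 : ‖p.2.1 - p'.2.1‖ ≤ ‖p - p'‖ := (norm_fst_le (p - p').2).trans (norm_snd_le (p - p'))
  have h3 : ‖p.2.2 - p'.2.2‖ ≤ ‖p - p'‖ := (norm_snd_le (p - p').2).trans (norm_snd_le (p - p'))
  set h := ‖p - p'‖ with hh
  have hh0 : 0 ≤ h := norm_nonneg _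
  refine (mul_le_mul_of_nonneg_right (min_le_left _ _) (norm_nonneg _)).trans ?_
  change D * ‖F p - F p'‖ ≤ _
  rw [add_mul, add_mul]
  have hn1 : 0 ≤ 16 * M * h := by positivity
  have hn2 : 0 ≤ (R * C + 4 * C) * h := by positivity
  have hn3 : 0 ≤ R * |C'| * h := by positivity
  rcases le_or_gt D (8 * h) with hDh | hDh
  · -- Boundedness suffices if the distance of the two points is comparable to `D`.
    have : ‖F p - F p'‖ ≤ 2 * M := (norm_sub_le _ _).trans (by linarith [hM p, hM p'])
    have : D * ‖F p - F p'‖ ≤ 8 * h * (2 * M) := mul_le_mul hDh this (norm_nonneg _) (by positivity)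
    linarith
  have hDpos : 0 < D := by linarith
  rcases lt_or_ge D (δ / 2) with hDδ | hDδ
  · -- Near the singularity: move first in `(k_i, k_j)` and then in the momentum transfer.
    obtain ⟨H, hH, eH⟩ := exists_norm_add_eq_latticeDist b q
    set q₀ := q + H with hq₀
    set q₁ := p'.2.2 - p'.1 + H with hq₁
    have eD : ‖q₀‖ = D := eH
    have hq01 : ‖q₁ - q₀‖ ≤ 2 * h := by
      have e : q₁ - q₀ = (p.1 - p'.1) - (p.2.2 - p'.2.2) := by rw [hq₁, hq₀, hq]; abel
      rw [e]
      exact (norm_sub_le _ _).trans (by linarith)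
    have hFp : F p = f p.1 p.2.1 (p.1 + q₀) := by
      have e : p.1 + q₀ = p.2.2 + H := by rw [hq₀, hq]; abel
      rw [e, (hf.periodic H hH _ _ _).2.2]
    have hFp' : F p' = f p'.1 p'.2.1 (p'.1 + q₁) := by
      have e : p'.1 + q₁ = p'.2.2 + H := by rw [hq₁]; abel
      rw [e, (hf.periodic H hH _ _ _).2.2]
    have step1 : ‖F p - f p'.1 p'.2.1 (p'.1 + q₀)‖ ≤ C * h := by
      rw [hFp]
      have := convex_univ.norm_image_sub_le_of_norm_fderiv_le (𝕜 := ℝ)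
        (f := fun y : E × E => f y.1 y.2 (y.1 + q₀)) (C := C)
        (fun y _ => (hf.singularity.1 q₀).differentiable (by simp) y)
        (fun y _ => (hC q₀ (by rw [eD]; exact hDpos) (by rw [eD]; linarith) y).2.1)
        (Set.mem_univ (p'.1, p'.2.1)) (Set.mem_univ (p.1, p.2.1))
      refine this.trans (mul_le_mul_of_nonneg_left ?_ hC0)
      exact norm_prod_le_iff.mpr ⟨h1, h2⟩
    have step2 : ‖f p'.1 p'.2.1 (p'.1 + q₀) - F p'‖ ≤ C * (2 / D) * (2 * h) := by
      rw [hFp', norm_sub_rev]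
      have hball : ∀ x ∈ Metric.ball q₀ (D / 2), D / 2 < ‖x‖ ∧ ‖x‖ < δ ∧ x ∉ lattice b := by
        intro x hx
        rw [mem_ball_iff_norm] at hx
        have a1 : ‖q₀‖ ≤ ‖x‖ + ‖x - q₀‖ := by
          rw [norm_sub_rev]; exact norm_le_norm_add_norm_sub' q₀ x
        have a2 : ‖x‖ ≤ ‖q₀‖ + ‖x - q₀‖ := norm_le_norm_add_norm_sub' x q₀
        have a3 : latticeDist b q₀ = D := latticeDist_add b hH q
        have a4 := latticeDist_le_add_norm_sub b q₀ x
        rw [norm_sub_rev] at a4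
        exact ⟨by linarith, by linarith, (latticeDist_pos_iff b).mp (by linarith)⟩
      have := (convex_ball q₀ (D / 2)).norm_image_sub_le_of_norm_fderiv_le (𝕜 := ℝ)
        (f := fun x : E => f p'.1 p'.2.1 (p'.1 + x)) (C := C * (2 / D)) (x := q₀) (y := q₁)
        (fun x hx => ?_) (fun x hx => ?_) (Metric.mem_ball_self (by positivity))
        (by rw [mem_ball_iff_norm]; linarith)
      · exact this.trans (mul_le_mul_of_nonneg_left hq01 (by positivity))
      · have hmem : (p'.1, p'.2.1, p'.1 + x) ∈ U := by
          change p'.1 + x - p'.1 ∉ S.recipLattice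
          rw [add_sub_cancel_left]; exact (hball x hx).2.2
        exact (hdiff _ hmem).comp (f := fun x : E => (p'.1, p'.2.1, p'.1 + x)) x (by fun_prop)
      · obtain ⟨a1, a2, -⟩ := hball x hx
        refine (hC x (by linarith) a2 (p'.1, p'.2.1)).2.2.trans ?_
        have : ‖x‖⁻¹ ≤ 2 / D := by
          rw [← inv_div]
          exact inv_anti₀ (by positivity) a1.le
        gcongr
    have htri : ‖F p - F p'‖ ≤ C * h + C * (2 / D) * (2 * h) := by
      refine le_trans ?_ (add_le_add step1 step2)
      exact norm_sub_le_norm_sub_add_norm_sub _ _ _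
    have hfin : D * ‖F p - F p'‖ ≤ (R * C + 4 * C) * h := by
      calc _ ≤ D * (C * h + C * (2 / D) * (2 * h)) := by gcongr
        _ = D * (C * h) + 4 * C * h := by field_simp; ring
        _ ≤ R * (C * h) + 4 * C * h := by gcongr
        _ = _ := by ring
    linarith
  · -- Away from the singularity the total derivative is bounded.
    have hball : ∀ x ∈ Metric.ball p (D / 4), δ / 4 ≤ latticeDist b (x.2.2 - x.1) := by
      intro x hx
      rw [mem_ball_iff_norm] at hx
      have a1 : ‖x.1 - p.1‖ ≤ ‖x - p‖ := norm_fst_le (x - p)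
      have a2 : ‖x.2.2 - p.2.2‖ ≤ ‖x - p‖ := (norm_snd_le (x - p).2).trans (norm_snd_le (x - p))
      have a3 := latticeDist_le_add_norm_sub b q (x.2.2 - x.1)
      have a4 : ‖q - (x.2.2 - x.1)‖ ≤ ‖x.1 - p.1‖ + ‖x.2.2 - p.2.2‖ := by
        have e : q - (x.2.2 - x.1) = (x.1 - p.1) - (x.2.2 - p.2.2) := by rw [hq]; abel
        rw [e]; exact norm_sub_le _ _
      linarith
    have := (convex_ball p (D / 4)).norm_image_sub_le_of_norm_fderiv_le (𝕜 := ℝ) (f := F)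
      (C := |C'|) (x := p) (y := p')
      (fun x hx => hdiff x ((latticeDist_pos_iff b).mp (by linarith [hball x hx])))
      (fun x hx => (hC' x (hball x hx)).trans (le_abs_self _)) (Metric.mem_ball_self (by positivity))
      (by rw [mem_ball_iff_norm, norm_sub_rev]; linarith)
    rw [norm_sub_rev, norm_sub_rev p' p] at this
    have hfin : D * ‖F p - F p'‖ ≤ R * |C'| * h := by
      rw [mul_assoc]
      exact mul_le_mul hDR this (norm_nonneg _) hR0.le
    linarith

end AmplitudeSpace

/-! ### The sup norm of amplitudes -/

section SupNorm

variable {nocc nvir : ℕ} {K : Type}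

theorem enorm_le_supNorm (t : Amp nocc nvir K) (i j : Fin nocc) (a b : Fin nvir) (x y z : K) :
    ‖t i j a b x y z‖ₑ ≤ supNorm t := by
  unfold supNorm
  exact le_iSup_of_le i <| le_iSup_of_le j <| le_iSup_of_le a <| le_iSup_of_le b <|
    le_iSup_of_le x <| le_iSup_of_le y <| le_iSup_of_le z le_rfl

theorem supNorm_le {t : Amp nocc nvir K} {c : ℝ≥0∞}
    (h : ∀ i j a b x y z, ‖t i j a b x y z‖ₑ ≤ c) : supNorm t ≤ c := by
  unfold supNorm
  exact iSup_le fun i => iSup_le fun j => iSup_le fun a => iSup_le fun b => iSup_le fun x =>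
    iSup_le fun y => iSup_le fun z => h i j a b x y z

theorem supNorm_sub_le (r s t : Amp nocc nvir K) :
    supNorm (r - t) ≤ supNorm (r - s) + supNorm (s - t) := by
  refine supNorm_le fun i j a b x y z => ?_
  have e : (r - t) i j a b x y z = (r - s) i j a b x y z + (s - t) i j a b x y z :=
    (sub_add_sub_cancel _ _ _).symm
  rw [e]
  exact (enorm_add_le _ _).trans (add_le_add (enorm_le_supNorm _ _ _ _ _ _ _ _)
    (enorm_le_supNorm _ _ _ _ _ _ _ _))

theorem supNorm_lt_top [Finite K] (t : Amp nocc nvir K) : supNorm t < ⊤ := by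
  obtain ⟨M, hM⟩ := Finite.exists_le
    fun p : Fin nocc × Fin nocc × Fin nvir × Fin nvir × K × K × K =>
      ‖t p.1 p.2.1 p.2.2.1 p.2.2.2.1 p.2.2.2.2.1 p.2.2.2.2.2.1 p.2.2.2.2.2.2‖
  refine lt_of_le_of_lt (supNorm_le (c := ENNReal.ofReal M) fun i j a b x y z => ?_)
    ENNReal.ofReal_lt_top
  rw [← ofReal_norm]
  exact ENNReal.ofReal_le_ofReal (hM (i, j, a, b, x, y, z))

variable (S : PeriodicSystem nocc nvir)

theorem supNorm_lt_top_of_mem_amplitudeSpace {t : Amp nocc nvir E} (ht : t ∈ S.amplitudeSpace) :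
    supNorm t < ⊤ := by
  choose M hM using fun i j a b => (ht i j a b).exists_norm_le
  obtain ⟨M', hM'⟩ := Finite.exists_le
    fun p : Fin nocc × Fin nocc × Fin nvir × Fin nvir => M p.1 p.2.1 p.2.2.1 p.2.2.2
  refine lt_of_le_of_lt (supNorm_le (c := ENNReal.ofReal M') fun i j a b x y z => ?_)
    ENNReal.ofReal_lt_top
  rw [← ofReal_norm]
  exact ENNReal.ofReal_le_ofReal ((hM i j a b (x, y, z)).trans (hM' (i, j, a, b)))

theorem supNorm_sample_sub_sample_le (k₀ : E) (m : ℕ+) (s t : Amp nocc nvir E) :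
    supNorm (S.sample k₀ m s - S.sample k₀ m t) ≤ supNorm (s - t) :=
  supNorm_le fun i j a b _ _ _ => enorm_le_supNorm (s - t) i j a b _ _ _

end SupNorm

/-! ### Convergence of the amplitudes -/

section Contraction

variable {nocc nvir : ℕ} (S : PeriodicSystem nocc nvir)

/-- A discrete Gronwall inequality for a contraction with error `ε` in each step. -/
theorem le_of_le_add_mul {x : ℕ → ℝ≥0∞} {ε L : ℝ≥0∞} (hL : L < 1)
    (hx : ∀ n, x (n + 1) ≤ ε + L * x n) (n : ℕ) : x n ≤ ε * (1 - L)⁻¹ + L ^ n * x 0 := by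
  have hK : 1 + L * (1 - L)⁻¹ = (1 - L)⁻¹ := by
    have h1 : (1 - L) * (1 - L)⁻¹ = 1 :=
      ENNReal.mul_inv_cancel (tsub_pos_of_lt hL).ne' (ENNReal.sub_ne_top ENNReal.one_ne_top)
    nth_rewrite 1 [← h1]
    rw [← add_mul, tsub_add_cancel_of_le hL.le, one_mul]
  induction n with
  | zero => simp
  | succ n ih =>
    calc x (n + 1) ≤ ε + L * (ε * (1 - L)⁻¹ + L ^ n * x 0) := (hx n).trans (by gcongr)
      _ = ε * (1 + L * (1 - L)⁻¹) + L ^ (n + 1) * x 0 := by ring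
      _ = _ := by rw [hK]

/-- If sampling commutes up to `ε` with one step of the fixed-point iterations, then it maps the
fixed point in the thermodynamic limit to within `ε / (1 - L)` of the fixed point on the mesh. -/
theorem supNorm_sample_sub_le (k₀ : E) (m : ℕ+) {L : ℝ≥0} (hL : L < 1)
    {B : Set (Amp nocc nvir E)} {t : Amp nocc nvir E} (htB : t ∈ B) (ht : S.mapTDL t = t)
    (htfin : supNorm t < ⊤) (hB0 : 0 ∈ B) (hBmaps : Set.MapsTo S.mapTDL B B)
    (hBcontr : ∀ t₁ ∈ B, ∀ t₂ ∈ B,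
      supNorm (S.mapTDL t₁ - S.mapTDL t₂) ≤ (L : ℝ≥0∞) * supNorm (t₁ - t₂))
    {D : Set (Amp nocc nvir (MeshIndex m))} {T : Amp nocc nvir (MeshIndex m)}
    (hTD : T ∈ D) (hT : S.mapFin k₀ m T = T)
    (hDcontr : ∀ T₁ ∈ D, ∀ T₂ ∈ D,
      supNorm (S.mapFin k₀ m T₁ - S.mapFin k₀ m T₂) ≤ (L : ℝ≥0∞) * supNorm (T₁ - T₂))
    (hBD : Set.MapsTo (S.sample k₀ m) B D) {ε : ℝ≥0∞}
    (hε : ∀ n : ℕ, 0 < n →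
      supNorm (S.sample k₀ m (S.mapTDL (S.mapTDL^[n] 0))
          - S.mapFin k₀ m (S.sample k₀ m (S.mapTDL^[n] 0))) ≤ ε) :
    supNorm (S.sample k₀ m t - T) ≤ ε * (1 - (L : ℝ≥0∞))⁻¹ := by
  have hL' : (L : ℝ≥0∞) < 1 := by exact_mod_cast hL
  have hiter : ∀ n, S.mapTDL^[n] 0 ∈ B := fun n => hBmaps.iterate n hB0
  -- The iterates converge to the fixed point in the thermodynamic limit.
  have hdist : ∀ n, supNorm (t - S.mapTDL^[n] 0) ≤ (L : ℝ≥0∞) ^ n * supNorm t := by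
    intro n
    induction n with
    | zero => simp
    | succ n ih =>
      rw [Function.iterate_succ_apply']
      nth_rewrite 1 [← ht]
      refine (hBcontr _ htB _ (hiter n)).trans ?_
      rw [pow_succ', mul_assoc]
      gcongr
  have hstep : ∀ n, supNorm (S.sample k₀ m (S.mapTDL^[n + 1 + 1] 0) - T)
      ≤ ε + (L : ℝ≥0∞) * supNorm (S.sample k₀ m (S.mapTDL^[n + 1] 0) - T) := by
    intro n
    rw [Function.iterate_succ_apply' S.mapTDL (n + 1)]
    refine (supNorm_sub_le _ (S.mapFin k₀ m (S.sample k₀ m (S.mapTDL^[n + 1] 0))) _).trans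
      (add_le_add (hε (n + 1) n.succ_pos) ?_)
    nth_rewrite 1 [← hT]
    exact hDcontr _ (hBD (hiter _)) _ hTD
  have hrec := le_of_le_add_mul
    (x := fun n => supNorm (S.sample k₀ m (S.mapTDL^[n + 1] 0) - T)) hL' hstep
  set x₀ := supNorm (S.sample k₀ m (S.mapTDL^[0 + 1] 0) - T) with hx₀
  have hx₀fin : x₀ < ⊤ := supNorm_lt_top _
  have hle : ∀ n : ℕ, supNorm (S.sample k₀ m t - T)
      ≤ (L : ℝ≥0∞) ^ (n + 1) * supNorm t + (ε * (1 - (L : ℝ≥0∞))⁻¹ + (L : ℝ≥0∞) ^ n * x₀) := by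
    intro n
    refine (supNorm_sub_le _ (S.sample k₀ m (S.mapTDL^[n + 1] 0)) _).trans
      (add_le_add ?_ (hrec n))
    exact (supNorm_sample_sub_sample_le S k₀ m _ _).trans (hdist (n + 1))
  have hpow : Tendsto (fun n : ℕ => (L : ℝ≥0∞) ^ n) atTop (nhds 0) :=
    ENNReal.tendsto_pow_atTop_nhds_zero_of_lt_one hL'
  have h1 : Tendsto (fun n : ℕ => (L : ℝ≥0∞) ^ (n + 1) * supNorm t) atTop (nhds 0) := by
    simpa using ENNReal.Tendsto.mul_const ((tendsto_add_atTop_iff_nat 1).mpr hpow)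
      (Or.inr htfin.ne)
  have h2 : Tendsto (fun n : ℕ => (L : ℝ≥0∞) ^ n * x₀) atTop (nhds 0) := by
    simpa using ENNReal.Tendsto.mul_const hpow (Or.inr hx₀fin.ne)
  have h3 := h1.add ((tendsto_const_nhds (x := ε * (1 - (L : ℝ≥0∞))⁻¹)).add h2)
  rw [add_zero, zero_add] at h3
  exact ge_of_tendsto' h3 hle

end Contraction

/-! ### The energy -/

section Energy

variable {nocc nvir : ℕ} (S : PeriodicSystem nocc nvir)

/-- The energy on the mesh is Lipschitz continuous in the amplitude, uniformly in the mesh, because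
the antisymmetrized integrals are bounded. -/
theorem exists_norm_energyFin_sub_le : ∃ C : ℝ, 0 ≤ C ∧ ∀ (k₀ : E) (m : ℕ+)
    (T T' : Amp nocc nvir (MeshIndex m)) {δ : ℝ}, 0 ≤ δ → supNorm (T - T') ≤ ENNReal.ofReal δ →
      ‖S.energyFin k₀ m T - S.energyFin k₀ m T'‖ ≤ C * δ := by
  choose M hM using fun i j a b => (isMildlySingular_antisymERI S i j a b).bounded
  have hM0 : ∀ i j a b, 0 ≤ M i j a b := fun i j a b => (norm_nonneg _).trans (hM i j a b 0)
  refine ⟨∑ i, ∑ j, ∑ a, ∑ b, M i j a b, by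
    refine Finset.sum_nonneg fun i _ => Finset.sum_nonneg fun j _ => Finset.sum_nonneg fun a _ =>
      Finset.sum_nonneg fun b _ => hM0 i j a b, fun k₀ m T T' δ hδ h => ?_⟩
  have hentry : ∀ i j a b x y z, ‖T i j a b x y z - T' i j a b x y z‖ ≤ δ := by
    intro i j a b x y z
    have := (enorm_le_supNorm (T - T') i j a b x y z).trans h
    rwa [← ofReal_norm, ENNReal.ofReal_le_ofReal_iff hδ] at this
  have hN : (0 : ℝ) < Nk m := by
    rw [← card_meshIndex]; exact_mod_cast Fintype.card_pos
  rw [PeriodicSystem.energyFin, PeriodicSystem.energyFin, ← mul_sub]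
  simp only [← Finset.sum_sub_distrib, ← mul_sub]
  have hpt : ∀ x y z, ‖∑ i, ∑ j, ∑ a, ∑ b,
      S.antisymERI i j a b (S.meshPoint k₀ m x) (S.meshPoint k₀ m y) (S.meshPoint k₀ m z)
        * (T i j a b x y z - T' i j a b x y z)‖ ≤ (∑ i, ∑ j, ∑ a, ∑ b, M i j a b) * δ := by
    intro x y z
    simp only [Finset.sum_mul]
    refine norm_sum_le_of_le _ fun i _ => norm_sum_le_of_le _ fun j _ => norm_sum_le_of_le _
      fun a _ => norm_sum_le_of_le _ fun b _ => ?_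
    rw [norm_mul]
    exact mul_le_mul (hM i j a b (_, _, _)) (hentry i j a b x y z) (norm_nonneg _) (hM0 i j a b)
  set c := (∑ i, ∑ j, ∑ a, ∑ b, M i j a b) * δ with hc
  have hsum := norm_sum_le_of_le (Finset.univ : Finset (MeshIndex m)) fun x _ =>
    norm_sum_le_of_le (Finset.univ : Finset (MeshIndex m)) fun y _ =>
      norm_sum_le_of_le (Finset.univ : Finset (MeshIndex m)) fun z _ => hpt x y z
  rw [norm_mul, norm_div, norm_one, norm_pow, Complex.norm_natCast]
  refine (mul_le_mul_of_nonneg_left hsum (by positivity)).trans (le_of_eq ?_)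
  simp only [Finset.sum_const, Finset.card_univ, card_meshIndex, nsmul_eq_mul]
  field_simp

/-- Quadrature error of the energy of an amplitude in `𝕋(Ω*)`. -/
theorem exists_norm_energyTDL_sub_energyFin_sample_le {t : Amp nocc nvir E}
    (ht : t ∈ S.amplitudeSpace) : ∃ C : ℝ, ∀ (k₀ : E) (m : ℕ+),
      ‖S.energyTDL t - S.energyFin k₀ m (S.sample k₀ m t)‖ ≤ C * (1 / (m : ℝ)) := by
  have h : IsMildlySingular (recipBasis S.prim) fun p => ∑ i, ∑ j, ∑ a, ∑ b,
      S.antisymERI i j a b p.1 p.2.1 p.2.2 * t i j a b p.1 p.2.1 p.2.2 :=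
    .sum _ fun i => .sum _ fun j => .sum _ fun a => .sum _ fun b =>
      (isMildlySingular_antisymERI S i j a b).mul (ht i j a b).isMildlySingular
  exact h.exists_norm_average_sub_le S

end Energy

end PeriodicCCD

end

theorem corollary3 {nocc nvir : ℕ} (S : PeriodicSystem nocc nvir)
    -- offsets of the Monkhorst-Pack meshes
    (k₀ : ℕ+ → E)
    -- the contraction constant
    (L : ℝ≥0) (hL : L < 1)
    -- `ℱ_TDL` is a contraction of the domain `B`, which contains zero and the fixed point `t`
    (B : Set (Amp nocc nvir E)) (hB : B ⊆ S.amplitudeSpace)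
    (t : Amp nocc nvir E) (htB : t ∈ B) (ht : S.mapTDL t = t) (hB0 : 0 ∈ B)
    (hBmaps : Set.MapsTo S.mapTDL B B)
    (hBcontr : ∀ t₁ ∈ B, ∀ t₂ ∈ B,
      supNorm (S.mapTDL t₁ - S.mapTDL t₂) ≤ (L : ℝ≥0∞) * supNorm (t₁ - t₂))
    -- for large meshes, `ℱ_{N_k}` is a contraction of the domain `D m`, which contains zero and
    -- the fixed point `T m`, in the entrywise max norm
    (D : ∀ m : ℕ+, Set (Amp nocc nvir (MeshIndex m)))
    (T : ∀ m : ℕ+, Amp nocc nvir (MeshIndex m))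
    (hTD : ∀ᶠ m in atTop, T m ∈ D m)
    (hT : ∀ᶠ m in atTop, S.mapFin (k₀ m) m (T m) = T m)
    (hD0 : ∀ᶠ m in atTop, 0 ∈ D m)
    (hDmaps : ∀ᶠ m in atTop, Set.MapsTo (S.mapFin (k₀ m) m) (D m) (D m))
    (hDcontr : ∀ᶠ m in atTop, ∀ T₁ ∈ D m, ∀ T₂ ∈ D m,
      supNorm (S.mapFin (k₀ m) m T₁ - S.mapFin (k₀ m) m T₂) ≤ (L : ℝ≥0∞) * supNorm (T₁ - T₂))
    -- for large meshes, sampling maps the domain `B` into the domain `D m`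
    (hBD : ∀ᶠ m in atTop, Set.MapsTo (S.sample (k₀ m) m) B (D m))
    -- the one-step errors of the iterates are `O(N_k^{-1/3})` uniformly in the iterate
    (C : ℝ)
    (hC : ∀ᶠ m in atTop, ∀ n : ℕ, 0 < n →
      supNorm (S.sample (k₀ m) m (S.mapTDL (S.mapTDL^[n] 0))
          - S.mapFin (k₀ m) m (S.sample (k₀ m) m (S.mapTDL^[n] 0)))
        ≤ ENNReal.ofReal (C * (Nk m : ℝ) ^ (-(1 / 3) : ℝ))) :
    (fun m : ℕ+ => S.energyTDL t - S.energyFin (k₀ m) m (T m))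
      =O[atTop] fun m : ℕ+ => (Nk m : ℝ) ^ (-(1 / 3) : ℝ) := by
  obtain ⟨Cq, hCq⟩ := exists_norm_energyTDL_sub_energyFin_sample_le S (hB htB)
  obtain ⟨Ce, hCe0, hCe⟩ := exists_norm_energyFin_sub_le S
  have hL1 : 0 < 1 - (L : ℝ) := sub_pos.mpr (by exact_mod_cast hL)
  refine IsBigO.of_bound (Cq + Ce * (|C| / (1 - L))) ?_
  filter_upwards [hTD, hT, hDcontr, hBD, hC] with m hTD hT hDcontr hBD hC
  have hm : (0 : ℝ) < m := by exact_mod_cast m.pos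
  have hamp := supNorm_sample_sub_le S (k₀ m) m hL htB ht
    (supNorm_lt_top_of_mem_amplitudeSpace S (hB htB)) hB0 hBmaps hBcontr hTD hT hDcontr hBD hC
  rw [Nk_rpow] at hamp ⊢
  have hδ : ENNReal.ofReal (C * (1 / (m : ℝ))) * (1 - (L : ℝ≥0∞))⁻¹
      ≤ ENNReal.ofReal (|C| / (1 - L) * (1 / (m : ℝ))) := by
    have e : (1 - (L : ℝ≥0∞))⁻¹ = ENNReal.ofReal (1 - (L : ℝ))⁻¹ := by
      rw [ENNReal.ofReal_inv_of_pos hL1, ENNReal.ofReal_sub 1 L.coe_nonneg]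
      simp
    rw [e, ← ENNReal.ofReal_mul' (by positivity)]
    refine ENNReal.ofReal_le_ofReal ?_
    calc C * (1 / (m : ℝ)) * (1 - (L : ℝ))⁻¹ ≤ |C| * (1 / (m : ℝ)) * (1 - (L : ℝ))⁻¹ := by
          gcongr; exact le_abs_self C
      _ = _ := by ring
  have henergy := hCe (k₀ m) m _ _ (by positivity) (hamp.trans hδ)
  rw [Real.norm_of_nonneg (by positivity)]
  calc ‖S.energyTDL t - S.energyFin (k₀ m) m (T m)‖
      ≤ ‖S.energyTDL t - S.energyFin (k₀ m) m (S.sample (k₀ m) m t)‖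
        + ‖S.energyFin (k₀ m) m (S.sample (k₀ m) m t) - S.energyFin (k₀ m) m (T m)‖ :=
        norm_sub_le_norm_sub_add_norm_sub _ _ _
    _ ≤ Cq * (1 / (m : ℝ)) + Ce * (|C| / (1 - L) * (1 / (m : ℝ))) :=
        add_le_add (hCq (k₀ m) m) henergy
    _ = _ := by ring
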